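/- For a functor $F:\mathcal A\to\mathcal B$ between small categories let $MF$ be the category whose objects are pairs $(A,\,x:B\xrightarrow{\cong}FA)$, with $A$ an object of $\mathcal A$ and $x$ an isomorphism of $\mathcal B$, and whose arrows $(A,x:B\cong FA)\to(A',x':B'\cong FA')$ are pairs $(b:B\to B',\,a:A\to A')$ with $x'b=F(a)\,x$. Let $RF:MF\to\mathcal B$ be the functor $(A,x:B\cong FA)\mapsto B$ and let $LF:\mathcal A\to MF$ be the functor $A\mapsto(A,\mathrm{id}_{FA})$. A commutative square $(H,K):F\to G$ of functors ($KF=GH$) induces the functor $MF\to MG$, $(A,x)\mapsto(HA,Kx)$, so that $R$ is an endofunctor of the category $\mathbf{Cat}^{\mathbf 2}$ of arrows of $\mathbf{Cat}$. It is a monad with unit $(LF,\mathrm{id}_{\mathcal B}):F\to RF$ and multiplication $(\mu_F,\mathrm{id}_{\mathcal B}):RRF\to RF$, where $\mu_F\bigl((A,x:B\cong FA),\,x':B'\cong B\bigr)=(A,\,xx':B'\cong FA)$. (This is the monad of the algebraic weak factorisation system on $\mathbf{Cat}$ whose algebras are the split cloven isofibrations.) Let $R\text{-}\mathbf{Alg}$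 be the category of algebras for this monad, and let $S:R\text{-}\mathbf{Alg}\to\mathbf{Cat}$ be the functor that sends an algebra with underlying functor $F:\mathcal A\to\mathcal B$ to $\mathcal B$, and a morphism of algebras to the codomain part of its underlying square. Then $S$ is an elementary fibration. That is: $S$ is a Grothendieck fibration; $\mathbf{Cat}$ and every fibre of $S$ have finite products, and every reindexing functor $f^*$ preserves them; for all small categories $Y,X$, reindexing along the parametrised diagonal $\delta_{Y,X}=\langle \mathrm{pr}_1,\mathrm{pr}_2,\mathrm{pr}_2\rangle:Y\times X\to Y\times X\times X$ has a left adjoint $\Sigma_{Y,X}$; and these left adjoints satisfy * Frobenius Reciprocity: for all $Y,X$, every $A$ in the fibre over $Y\times X$ and every $B$ in the fibre over $Y\times X\times X$, the canonical arrow $\Sigma_{Y,X}(\delta_{Y,X}^*B\wedge A)\to B\wedge\Sigma_{Y,X}A$ is an isomorphism, where $\wedge$ denotes the product in a fibre; * the Beck–Chevalley Condition: for all $f:Y\to Z$ and $X$ in $\mathbf{Cat}$ and every $A$ in the fibre over $Z\times X$, the canonical arrow $\Sigma_{Y,X}(f\times X)^*A\to(f\times X\times X)^*\Sigma_{Z,X}A$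 is an isomorphism. -/

import Mathlib

universe v₁ v₂ u₁ u₂ u

namespace ElementaryFib

open CategoryTheory CategoryTheory.Limits CategoryTheory.Functor MonoidalCategory
  CartesianMonoidalCategory

/-! ### Reindexing in a fibration -/

section Fibrations

variable {E : Type u₂} {B : Type u₁} [Category.{v₂} E] [Category.{v₁} B]

instance fiberHom_isHomLift (p : E ⥤ B) {X : B} {A A' : Fiber p X} (g : A ⟶ A') :
    p.IsHomLift (𝟙 X) g.1 := g.2

open IsPreFibered in
/-- The reindexing functor `f^* : E_Y ⥤ E_X` along `f : X ⟶ Y`, for the chosen cleavage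
`IsPreFibered.pullbackMap`. -/
noncomputable def reindex (p : E ⥤ B) [p.IsFibered] {X Y : B} (f : X ⟶ Y) :
    Fiber p Y ⥤ Fiber p X where
  obj A := ⟨pullbackObj A.2 f, pullbackObj_proj A.2 f⟩
  map {A A'} g := ⟨IsCartesian.map p f (pullbackMap A'.2 f) (pullbackMap A.2 f ≫ g.1),
    inferInstance⟩
  map_id A := by
    apply Subtype.ext
    change IsCartesian.map p f (pullbackMap A.2 f) (pullbackMap A.2 f ≫ 𝟙 A.1) = 𝟙 _
    have : p.IsHomLift (𝟙 X) (𝟙 (pullbackObj A.2 f)) := IsHomLift.id (pullbackObj_proj A.2 f)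
    exact (IsCartesian.map_uniq p f _ _ _ (by rw [Category.id_comp, Category.comp_id])).symm
  map_comp {A A' A''} g h := by
    apply Subtype.ext
    change IsCartesian.map p f (pullbackMap A''.2 f) (pullbackMap A.2 f ≫ g.1 ≫ h.1) =
      IsCartesian.map p f (pullbackMap A'.2 f) (pullbackMap A.2 f ≫ g.1) ≫
        IsCartesian.map p f (pullbackMap A''.2 f) (pullbackMap A'.2 f ≫ h.1)
    refine (IsCartesian.map_uniq p f _ _ _ ?_).symm
    rw [Category.assoc, IsCartesian.fac, IsCartesian.fac_assoc, Category.assoc]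

/-- The chosen cartesian lift `f^* A ⟶ A` of `f : X ⟶ Y` into an object `A` over `Y`. -/
noncomputable def cartLift (p : E ⥤ B) [p.IsFibered] {X Y : B} (f : X ⟶ Y) (A : Fiber p Y) :
    ((reindex p f).obj A).1 ⟶ A.1 :=
  IsPreFibered.pullbackMap A.2 f

instance cartLift_isCartesian (p : E ⥤ B) [p.IsFibered] {X Y : B} (f : X ⟶ Y)
    (A : Fiber p Y) : p.IsCartesian f (cartLift p f A) :=
  inferInstanceAs (p.IsCartesian f (IsPreFibered.pullbackMap A.2 f))

/-- For a commutative square `u ≫ d' = d ≫ v` in the base, the canonical vertical comparison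
`u^* d'^* C ⟶ d^* v^* C`: the unique vertical arrow compatible with the cartesian lifts to `C`
(see `reindexSquare_fac`). -/
noncomputable def reindexSquare (p : E ⥤ B) [p.IsFibered] {W W' Z Z' : B} {u : W ⟶ W'}
    {d : W ⟶ Z} {d' : W' ⟶ Z'} {v : Z ⟶ Z'} (h : u ≫ d' = d ≫ v) (C : Fiber p Z') :
    (reindex p u).obj ((reindex p d').obj C) ⟶ (reindex p d).obj ((reindex p v).obj C) :=
  haveI : p.IsHomLift (d ≫ v)
      (cartLift p u ((reindex p d').obj C) ≫ cartLift p d' C) := by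
    rw [← h]; exact IsHomLift.comp p _ _ _ _
  ⟨IsCartesian.map p (d ≫ v) (cartLift p d ((reindex p v).obj C) ≫ cartLift p v C)
    (cartLift p u ((reindex p d').obj C) ≫ cartLift p d' C), inferInstance⟩

lemma reindexSquare_fac (p : E ⥤ B) [p.IsFibered] {W W' Z Z' : B} {u : W ⟶ W'}
    {d : W ⟶ Z} {d' : W' ⟶ Z'} {v : Z ⟶ Z'} (h : u ≫ d' = d ≫ v) (C : Fiber p Z') :
    (reindexSquare p h C).1 ≫ cartLift p d ((reindex p v).obj C) ≫ cartLift p v C =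
      cartLift p u ((reindex p d').obj C) ≫ cartLift p d' C :=
  haveI : p.IsHomLift (d ≫ v)
      (cartLift p u ((reindex p d').obj C) ≫ cartLift p d' C) := by
    rw [← h]; exact IsHomLift.comp p _ _ _ _
  IsCartesian.fac p (d ≫ v) (cartLift p d ((reindex p v).obj C) ≫ cartLift p v C) _

/-! ### Fibrations with finite products -/

/-- A fibration over a base with (chosen) finite products has finite products if every fibre has
finite products and every reindexing functor preserves them. -/
structure HasFibredProducts (p : E ⥤ B) [p.IsFibered] [CartesianMonoidalCategory B] : Prop where
  fibre : ∀ X : B, HasFiniteProducts (Fiber p X)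
  reindex : ∀ {X Y : B} (f : X ⟶ Y), PreservesFiniteProducts (reindex p f)

/-! ### Elementary fibrations -/

section Diagonal

variable [CartesianMonoidalCategory B]

/-- The parametrised diagonal `⟨pr₁, pr₂, pr₂⟩ : Y × X ⟶ Y × X × X`. -/
def parDiag (Y X : B) : Y ⊗ X ⟶ (Y ⊗ X) ⊗ X :=
  lift (𝟙 (Y ⊗ X)) (snd Y X)

lemma parDiag_naturality {Y Z : B} (f : Y ⟶ Z) (X : B) :
    (f ▷ X) ≫ parDiag Z X = parDiag Y X ≫ ((f ▷ X) ▷ X) := by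
  unfold parDiag
  ext <;> simp

end Diagonal

/-- The canonical arrow `L (d^* B' ∧ A) ⟶ B' ∧ L A` for a left adjoint `L` of `d^*`. Its first
component is the transpose of the projection `d^* B' ∧ A ⟶ d^* B'`. -/
noncomputable def frobeniusMap (p : E ⥤ B) [p.IsFibered] {W Z : B} [HasFiniteProducts (Fiber p W)]
    [HasFiniteProducts (Fiber p Z)] {d : W ⟶ Z} {L : Fiber p W ⥤ Fiber p Z}
    (adj : L ⊣ reindex p d) (A : Fiber p W) (B' : Fiber p Z) :
    L.obj ((reindex p d).obj B' ⨯ A) ⟶ B' ⨯ L.obj A :=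
  prod.lift ((adj.homEquiv _ _).symm prod.fst) (L.map prod.snd)

/-- The canonical arrow `L (u^* A) ⟶ v^* (L' A)` for a commutative square `u ≫ d' = d ≫ v` and
left adjoints `L` of `d^*` and `L'` of `d'^*`: the transpose of
`u^* A ⟶ u^* d'^* L' A ⟶ d^* v^* L' A`. -/
noncomputable def beckChevalleyMap (p : E ⥤ B) [p.IsFibered] {W W' Z Z' : B} {u : W ⟶ W'}
    {d : W ⟶ Z} {d' : W' ⟶ Z'} {v : Z ⟶ Z'} (h : u ≫ d' = d ≫ v)
    {L : Fiber p W ⥤ Fiber p Z} {L' : Fiber p W' ⥤ Fiber p Z'}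
    (adj : L ⊣ reindex p d) (adj' : L' ⊣ reindex p d') (A : Fiber p W') :
    L.obj ((reindex p u).obj A) ⟶ (reindex p v).obj (L'.obj A) :=
  (adj.homEquiv _ _).symm ((reindex p u).map (adj'.unit.app A) ≫ reindexSquare p h (L'.obj A))

/-- A functor is an elementary fibration if it is a fibration with finite products such that
reindexing along every parametrised diagonal has a left adjoint, and these left adjoints satisfy
Frobenius Reciprocity and the Beck-Chevalley Condition. -/
def IsElementaryFibration [CartesianMonoidalCategory B] (p : E ⥤ B) : Prop :=
  ∃ (_ : p.IsFibered) (hprod : HasFibredProducts p)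
    (L : ∀ Y X : B, Fiber p (Y ⊗ X) ⥤ Fiber p ((Y ⊗ X) ⊗ X))
    (adj : ∀ Y X : B, L Y X ⊣ reindex p (parDiag Y X)),
    (∀ (Y X : B) (A : Fiber p (Y ⊗ X)) (B' : Fiber p ((Y ⊗ X) ⊗ X)),
      haveI := hprod.fibre
      IsIso (frobeniusMap p (adj Y X) A B')) ∧
    (∀ (Y Z : B) (f : Y ⟶ Z) (X : B) (A : Fiber p (Z ⊗ X)),
      IsIso (beckChevalleyMap p (parDiag_naturality f X) (adj Y X) (adj Z X) A))

end Fibrations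

/-! ### The monad on `Cat^2` -/

section Factorisation

variable {𝒜 ℬ : Type u} [Category.{u} 𝒜] [Category.{u} ℬ]

/-- An object of `M F` is a pair `(A, x : B ≅ F A)`. -/
structure MObj (F : 𝒜 ⥤ ℬ) : Type u where
  src : 𝒜
  pt : ℬ
  iso : pt ≅ F.obj src

/-- An arrow `(A, x) ⟶ (A', x')` of `M F` is a pair `(b : B ⟶ B', a : A ⟶ A')` such that
`x' ∘ b = F a ∘ x`. -/
@[ext]
structure MHom {F : 𝒜 ⥤ ℬ} (P Q : MObj F) : Type u where
  b : P.pt ⟶ Q.pt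
  a : P.src ⟶ Q.src
  w : b ≫ Q.iso.hom = P.iso.hom ≫ F.map a

instance (F : 𝒜 ⥤ ℬ) : Category.{u} (MObj F) where
  Hom P Q := MHom P Q
  id P := ⟨𝟙 _, 𝟙 _, by simp⟩
  comp f g := ⟨f.b ≫ g.b, f.a ≫ g.a, by
    rw [Category.assoc, g.w, ← Category.assoc, f.w, Category.assoc, Functor.map_comp]⟩
  id_comp f := MHom.ext (Category.id_comp _) (Category.id_comp _)
  comp_id f := MHom.ext (Category.comp_id _) (Category.comp_id _)
  assoc f g h := MHom.ext (Category.assoc _ _ _) (Category.assoc _ _ _)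

/-- The projection `M F ⥤ 𝒜`, `(A, x) ↦ A`. -/
def srcFunctor (F : 𝒜 ⥤ ℬ) : MObj F ⥤ 𝒜 where
  obj P := P.src
  map f := f.a

/-- The right factor `R F : M F ⥤ ℬ`, `(A, x : B ≅ F A) ↦ B`. -/
def rightFactor (F : 𝒜 ⥤ ℬ) : MObj F ⥤ ℬ where
  obj P := P.pt
  map f := f.b

/-- The left factor `L F : 𝒜 ⥤ M F`, `A ↦ (A, id : F A ≅ F A)`. -/
def leftFactor (F : 𝒜 ⥤ ℬ) : 𝒜 ⥤ MObj F where
  obj A := ⟨A, F.obj A, Iso.refl _⟩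
  map a := ⟨F.map a, a, by simp⟩
  map_id A := MHom.ext (F.map_id A) rfl
  map_comp a a' := MHom.ext (F.map_comp a a') rfl

/-- The multiplication `M (R F) ⥤ M F`, `((A, x : B ≅ F A), x' : B' ≅ B) ↦ (A, x ∘ x')`. -/
def mulFunctor (F : 𝒜 ⥤ ℬ) : MObj (rightFactor F) ⥤ MObj F where
  obj P := ⟨P.src.src, P.pt, P.iso ≪≫ P.src.iso⟩
  map {P Q} f := ⟨f.b, f.a.a, by
    have h1 : f.b ≫ Q.iso.hom = P.iso.hom ≫ f.a.b := f.w
    have h2 := f.a.w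
    change f.b ≫ Q.iso.hom ≫ Q.src.iso.hom = (P.iso.hom ≫ P.src.iso.hom) ≫ F.map f.a.a
    exact (Category.assoc _ _ _).symm.trans ((congrArg (· ≫ Q.src.iso.hom) h1).trans
      ((Category.assoc _ _ _).trans ((congrArg (P.iso.hom ≫ ·) h2).trans
        (Category.assoc _ _ _).symm)))⟩

variable {𝒞 𝒟 : Type u} [Category.{u} 𝒞] [Category.{u} 𝒟]

/-- The action of `M` on a strictly commutative square of functors:
`(A, x : B ≅ F A) ↦ (H A, K B ≅ K F A = G H A)`. -/
def mapFunctor {F : 𝒜 ⥤ ℬ} {G : 𝒞 ⥤ 𝒟} (H : 𝒜 ⥤ 𝒞) (K : ℬ ⥤ 𝒟) (h : F ⋙ K = H ⋙ G) :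
    MObj F ⥤ MObj G where
  obj P := ⟨H.obj P.src, K.obj P.pt, K.mapIso P.iso ≪≫ (eqToIso h).app P.src⟩
  map {P Q} f := ⟨K.map f.b, H.map f.a, by
    have h1 := (eqToIso h).hom.naturality f.a
    simp only [Functor.comp_map] at h1
    simp only [Iso.trans_hom, Functor.mapIso_hom, Iso.app_hom, Category.assoc]
    rw [← h1, ← Category.assoc, ← K.map_comp, f.w, K.map_comp, Category.assoc]⟩
  map_id P := MHom.ext (K.map_id _) (H.map_id _)
  map_comp f g := MHom.ext (K.map_comp _ _) (H.map_comp _ _)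

lemma MObj.ext' {F : 𝒜 ⥤ ℬ} {P Q : MObj F} (hs : P.src = Q.src) (hp : P.pt = Q.pt)
    (hi : P.iso.hom = eqToHom hp ≫ Q.iso.hom ≫ eqToHom (by rw [hs])) : P = Q := by
  obtain ⟨s, b, x⟩ := P
  obtain ⟨s', b', x'⟩ := Q
  obtain rfl : s = s' := hs
  obtain rfl : b = b' := hp
  obtain rfl : x = x' := by
    ext
    simpa using hi
  rfl

lemma MHom.heq {F : 𝒜 ⥤ ℬ} {P Q P' Q' : MObj F} (hP : P = P') (hQ : Q = Q') (f : MHom P Q)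
    (g : MHom P' Q') (hb : f.b ≍ g.b) (ha : f.a ≍ g.a) : f ≍ g := by
  subst hP hQ
  exact heq_of_eq (MHom.ext (eq_of_heq hb) (eq_of_heq ha))

/-- Two functors into `M F` agree if they have the same projections and the same isomorphisms. -/
lemma functor_ext_to_M {F : 𝒜 ⥤ ℬ} {H K : 𝒞 ⥤ MObj F} (hs : H ⋙ srcFunctor F = K ⋙ srcFunctor F)
    (hp : H ⋙ rightFactor F = K ⋙ rightFactor F)
    (hi : ∀ C, (H.obj C).iso.hom = eqToHom (Functor.congr_obj hp C) ≫ (K.obj C).iso.hom ≫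
      eqToHom (congrArg F.obj (Functor.congr_obj hs C).symm)) : H = K := by
  have hobj : ∀ C, H.obj C = K.obj C := fun C =>
    MObj.ext' (Functor.congr_obj hs C) (Functor.congr_obj hp C) (hi C)
  refine Functor.hext hobj fun C D f => ?_
  refine MHom.heq (hobj C) (hobj D) _ _ ?_ ?_
  · have := Functor.congr_hom hp f
    exact (conj_eqToHom_iff_heq _ _ (Functor.congr_obj hp C) (Functor.congr_obj hp D)).1 this
  · have := Functor.congr_hom hs f
    exact (conj_eqToHom_iff_heq _ _ (Functor.congr_obj hs C) (Functor.congr_obj hs D)).1 this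

lemma mapFunctor_id (F : 𝒜 ⥤ ℬ) (h : F ⋙ 𝟭 ℬ = 𝟭 𝒜 ⋙ F) :
    mapFunctor (𝟭 𝒜) (𝟭 ℬ) h = 𝟭 (MObj F) := by
  refine functor_ext_to_M rfl rfl fun P => ?_
  change P.iso.hom ≫ (eqToHom h).app P.src = 𝟙 _ ≫ P.iso.hom ≫ 𝟙 _
  rw [eqToHom_app]
  exact (Category.id_comp _).symm

lemma mapFunctor_comp {𝒳 𝒴 : Type u} [Category.{u} 𝒳] [Category.{u} 𝒴] {F : 𝒜 ⥤ ℬ} {G : 𝒞 ⥤ 𝒟}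
    {I : 𝒳 ⥤ 𝒴} (H : 𝒜 ⥤ 𝒞) (K : ℬ ⥤ 𝒟) (h : F ⋙ K = H ⋙ G) (H' : 𝒞 ⥤ 𝒳) (K' : 𝒟 ⥤ 𝒴)
    (h' : G ⋙ K' = H' ⋙ I) (h'' : F ⋙ K ⋙ K' = (H ⋙ H') ⋙ I) :
    mapFunctor (H ⋙ H') (K ⋙ K') h'' = mapFunctor H K h ⋙ mapFunctor H' K' h' := by
  refine functor_ext_to_M rfl rfl fun P => ?_
  change K'.map (K.map P.iso.hom) ≫ (eqToHom h'').app P.src = 𝟙 _ ≫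
    (K'.map (K.map P.iso.hom ≫ (eqToHom h).app P.src) ≫ (eqToHom h').app (H.obj P.src)) ≫ 𝟙 _
  simp [eqToHom_app, eqToHom_map]

lemma leftFactor_naturality {F : 𝒜 ⥤ ℬ} {G : 𝒞 ⥤ 𝒟} (H : 𝒜 ⥤ 𝒞) (K : ℬ ⥤ 𝒟)
    (h : F ⋙ K = H ⋙ G) : H ⋙ leftFactor G = leftFactor F ⋙ mapFunctor H K h := by
  refine functor_ext_to_M rfl h.symm fun A => ?_
  change 𝟙 (G.obj (H.obj A)) = eqToHom (Functor.congr_obj h.symm A) ≫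
    (K.map (𝟙 (F.obj A)) ≫ (eqToHom h).app A) ≫ 𝟙 _
  have e : (K.map (𝟙 (F.obj A)) ≫ (eqToHom h).app A) ≫ 𝟙 (G.obj (H.obj A)) =
      eqToHom (Functor.congr_obj h A) :=
    (Category.comp_id _).trans ((congrArg (· ≫ (eqToHom h).app A) (K.map_id _)).trans
      ((Category.id_comp _).trans (eqToHom_app h A)))
  exact ((congrArg (eqToHom (Functor.congr_obj h.symm A) ≫ ·) e).trans
    (eqToHom_trans (Functor.congr_obj h.symm A) (Functor.congr_obj h A))).symm

lemma mulFunctor_naturality {F : 𝒜 ⥤ ℬ} {G : 𝒞 ⥤ 𝒟} (H : 𝒜 ⥤ 𝒞) (K : ℬ ⥤ 𝒟)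
    (h : F ⋙ K = H ⋙ G) (h' : rightFactor F ⋙ K = mapFunctor H K h ⋙ rightFactor G) :
    mapFunctor (mapFunctor H K h) K h' ⋙ mulFunctor G = mulFunctor F ⋙ mapFunctor H K h := by
  refine functor_ext_to_M rfl rfl fun P => ?_
  change (K.map P.iso.hom ≫ 𝟙 _) ≫ (K.map P.src.iso.hom ≫ (eqToHom h).app P.src.src) =
    𝟙 _ ≫ (K.map (P.iso.hom ≫ P.src.iso.hom) ≫ (eqToHom h).app P.src.src) ≫ 𝟙 _
  rw [Category.comp_id, Category.id_comp, Category.comp_id]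
  exact (Category.assoc _ _ _).symm.trans
    (congrArg (· ≫ (eqToHom h).app P.src.src) (K.map_comp _ _).symm)

lemma mulFunctor_assoc (F : 𝒜 ⥤ ℬ)
    (h : rightFactor (rightFactor F) ⋙ 𝟭 ℬ = mulFunctor F ⋙ rightFactor F) :
    mapFunctor (mulFunctor F) (𝟭 ℬ) h ⋙ mulFunctor F =
      mulFunctor (rightFactor F) ⋙ mulFunctor F := by
  refine functor_ext_to_M rfl rfl fun P => ?_
  change (P.iso.hom ≫ 𝟙 _) ≫ (P.src.iso.hom ≫ P.src.src.iso.hom) =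
    𝟙 _ ≫ ((P.iso.hom ≫ P.src.iso.hom) ≫ P.src.src.iso.hom) ≫ 𝟙 _
  rw [Category.comp_id, Category.id_comp, Category.comp_id]
  exact (Category.assoc _ _ _).symm

lemma mulFunctor_left_unit (F : 𝒜 ⥤ ℬ) :
    leftFactor (rightFactor F) ⋙ mulFunctor F = 𝟭 (MObj F) := by
  refine functor_ext_to_M rfl rfl fun P => ?_
  change 𝟙 P.pt ≫ P.iso.hom = 𝟙 _ ≫ P.iso.hom ≫ 𝟙 _
  simp

lemma mulFunctor_right_unit (F : 𝒜 ⥤ ℬ) (h : F ⋙ 𝟭 ℬ = leftFactor F ⋙ rightFactor F) :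
    mapFunctor (leftFactor F) (𝟭 ℬ) h ⋙ mulFunctor F = 𝟭 (MObj F) := by
  refine functor_ext_to_M rfl rfl fun P => ?_
  change (P.iso.hom ≫ 𝟙 _) ≫ 𝟙 _ = 𝟙 _ ≫ P.iso.hom ≫ 𝟙 _
  simp

end Factorisation

lemma square_functor {F G : Arrow Cat.{u, u}} (s : F ⟶ G) :
    F.hom.toFunctor ⋙ s.right.toFunctor = s.left.toFunctor ⋙ G.hom.toFunctor :=
  congrArg Cat.Hom.toFunctor (Arrow.w s).symm

/-- The endofunctor `R` of `Cat^2`, sending `F : 𝒜 ⥤ ℬ` to `R F : M F ⥤ ℬ`. -/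
def rightFunctor : Arrow Cat.{u, u} ⥤ Arrow Cat.{u, u} where
  obj F := Arrow.mk (rightFactor F.hom.toFunctor).toCatHom
  map s := Arrow.homMk
    (mapFunctor s.left.toFunctor s.right.toFunctor (square_functor s)).toCatHom s.right rfl
  map_id _ := Arrow.hom_ext _ _ (Cat.ext (mapFunctor_id _ _)) rfl
  map_comp _ _ := Arrow.hom_ext _ _ (Cat.ext (mapFunctor_comp _ _ _ _ _ _ _)) rfl

/-- The monad `R` on `Cat^2`, with unit `L F : F ⟶ R F` and multiplication given by composition
of isomorphisms. -/
def rightMonad : Monad (Arrow Cat.{u, u}) where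
  toFunctor := rightFunctor
  η :=
    { app F := Arrow.homMk (leftFactor F.hom.toFunctor).toCatHom (𝟙 F.right) rfl
      naturality _ _ s :=
        Arrow.hom_ext _ _ (Cat.ext (leftFactor_naturality _ _ (square_functor s))) rfl }
  μ :=
    { app F := Arrow.homMk (mulFunctor F.hom.toFunctor).toCatHom (𝟙 F.right) rfl
      naturality _ _ s :=
        Arrow.hom_ext _ _ (Cat.ext (mulFunctor_naturality _ _ (square_functor s) rfl)) rfl }
  assoc _ := Arrow.hom_ext _ _ (Cat.ext (mulFunctor_assoc _ rfl)) rfl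
  left_unit _ := Arrow.hom_ext _ _ (Cat.ext (mulFunctor_left_unit _)) rfl
  right_unit _ := Arrow.hom_ext _ _ (Cat.ext (mulFunctor_right_unit _ rfl)) rfl

/-- The category of algebras for the monad `R`. -/
abbrev RAlg : Type (u + 1) := Monad.Algebra rightMonad.{u}

/-- The functor `S : R-Alg ⥤ Cat`, sending an algebra on `F : 𝒜 ⥤ ℬ` to `ℬ`. -/
def algCod : RAlg.{u} ⥤ Cat.{u, u} :=
  Monad.forget rightMonad ⋙ Arrow.rightFunc

end ElementaryFib

/-!
An algebra for the monad is a functor with a choice of lifts of isomorphisms that is functorial and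
closed under identities and composition; a morphism of algebras is a square preserving the chosen
lifts, and by uniqueness a natural transformation whose components are all chosen lifts is
determined by its codomain and its image in the base.

The forgetful functor to `Cat^2` creates pullbacks, so `S` preserves them, and `S` is an
isofibration. The algebras on identity functors are terminal in their fibres, over all arrows of
the base, hence a cartesian lift of `f : X ⟶ Y` is a pullback along `1_f : 1_X ⟶ 1_Y`, and products
in a fibre are pullbacks over its terminal object.

The left adjoint to reindexing along a graph `⟨1, P⟩ : W ⟶ W × X` sends an algebra `A` to the
pullback `C` of its reindexing along the projection `W × X ⟶ W` and of the algebra `M 1_X ⟶ X × X`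
of isomorphisms of `X`. The arrow `j : A ⟶ C` is a pullback of `r_X : 1_X ⟶ M 1_X`. It is
cocartesian because it has a retraction `r` with a natural family of chosen lifts from the identity
of `C` to `jr`, which forces how an arrow out of `A` extends to `C`. Conversely every pullback of
`r_X` over a graph is of this form, so Frobenius Reciprocity and the Beck–Chevalley Condition follow
by pasting pullbacks.
-/

namespace ElementaryFib

open CategoryTheory CategoryTheory.Limits CategoryTheory.Functor MonoidalCategory
  CartesianMonoidalCategory

open scoped CategoryTheory.Prod

/-! ### Left adjoints to reindexing -/

section LeftAdjoints

variable {E : Type u₂} {B : Type u₁} [Category.{v₂} E] [Category.{v₁} B] {p : E ⥤ B}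

lemma isIso_of_isIso_val {X : B} {A A' : Fiber p X} (g : A ⟶ A') [IsIso g.1] : IsIso g :=
  ⟨⟨inv g.1, inferInstance⟩, Subtype.ext (IsIso.hom_inv_id g.1), Subtype.ext (IsIso.inv_hom_id g.1)⟩

variable [p.IsFibered]

lemma reindex_map_fac {X Y : B} (f : X ⟶ Y) {A A' : Fiber p Y} (g : A ⟶ A') :
    ((reindex p f).map g).1 ≫ cartLift p f A' = cartLift p f A ≫ g.1 :=
  IsCartesian.fac p f (IsPreFibered.pullbackMap A'.2 f) (IsPreFibered.pullbackMap A.2 f ≫ g.1)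

lemma reindex_hom_ext {X Y : B} (f : X ⟶ Y) {A : Fiber p X} {A' : Fiber p Y}
    {g g' : A ⟶ (reindex p f).obj A'} (h : g.1 ≫ cartLift p f A' = g'.1 ≫ cartLift p f A') :
    g = g' :=
  Subtype.ext (IsCartesian.ext p f (cartLift p f A') g.1 g'.1 h)

/-- The vertical arrow `A ⟶ f^* A'` through which an arrow `A ⟶ A'` over `f` factors. -/
noncomputable def reindexLift {X Y : B} (f : X ⟶ Y) {A : Fiber p X} {A' : Fiber p Y}
    (φ : A.1 ⟶ A'.1) [p.IsHomLift f φ] : A ⟶ (reindex p f).obj A' :=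
  ⟨IsCartesian.map p f (cartLift p f A') φ, inferInstance⟩

lemma reindexLift_fac {X Y : B} (f : X ⟶ Y) {A : Fiber p X} {A' : Fiber p Y}
    (φ : A.1 ⟶ A'.1) [p.IsHomLift f φ] : (reindexLift f φ).1 ≫ cartLift p f A' = φ :=
  IsCartesian.fac p f (cartLift p f A') φ

variable {W Z : B} {d : W ⟶ Z}

lemma reindex_isRightAdjoint
    (h : ∀ A : Fiber p W, ∃ (C : Fiber p Z) (j : A.1 ⟶ C.1), p.IsCocartesian d j) :
    (reindex p d).IsRightAdjoint := by
  refine @isRightAdjointOfStructuredArrowInitials _ _ _ _ _ fun A => ?_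
  obtain ⟨C, j, hj⟩ := h A
  let desc (S : StructuredArrow A (reindex p d)) : C ⟶ S.right :=
    ⟨IsCocartesian.map p d j (S.hom.1 ≫ cartLift p d S.right), inferInstance⟩
  refine IsInitial.hasInitial (X := StructuredArrow.mk (Y := C) (reindexLift d j))
    (IsInitial.ofUniqueHom (fun S => StructuredArrow.homMk (desc S) (reindex_hom_ext d ?_))
      fun S m => StructuredArrow.ext _ _ (Subtype.ext ?_))
  · have hj' : (reindexLift d j).1 ≫ cartLift p d C = j := reindexLift_fac d j
    change ((reindexLift d j).1 ≫ ((reindex p d).map (desc S)).1) ≫ _ = S.hom.1 ≫ _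
    rw [Category.assoc, reindex_map_fac, reassoc_of% hj']
    exact IsCocartesian.fac p d j _
  · refine IsCocartesian.map_uniq p d j _ m.right.1 ?_
    have hj' : (reindexLift d j).1 ≫ cartLift p d C = j := reindexLift_fac d j
    have hm : (reindexLift d j).1 ≫ ((reindex p d).map m.right).1 = S.hom.1 :=
      congrArg Subtype.val (StructuredArrow.w m)
    have hm' := reindex_map_fac (A := C) (A' := S.right) d m.right
    rw [← hm]
    exact ((Category.assoc _ _ _).trans ((congrArg (_ ≫ ·) hm').trans
      ((Category.assoc _ _ _).symm.trans (congrArg (· ≫ m.right.1) hj')))).symm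

variable {L : Fiber p W ⥤ Fiber p Z} (adj : L ⊣ reindex p d)

/-- The arrow `A ⟶ L A` over `d` corresponding to the unit of an adjunction `L ⊣ d^*`. -/
noncomputable def unitLift (A : Fiber p W) : A.1 ⟶ (L.obj A).1 :=
  (adj.unit.app A).1 ≫ cartLift p d (L.obj A)

instance unitLift_isHomLift (A : Fiber p W) : p.IsHomLift d (unitLift adj A) :=
  inferInstanceAs (p.IsHomLift d ((adj.unit.app A).1 ≫ cartLift p d (L.obj A)))

lemma homEquiv_fac {A : Fiber p W} {C : Fiber p Z} (g : L.obj A ⟶ C) :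
    (adj.homEquiv A C g).1 ≫ cartLift p d C = unitLift adj A ≫ g.1 := by
  rw [adj.homEquiv_unit]
  change ((adj.unit.app A).1 ≫ ((reindex p d).map g).1) ≫ _ = _
  rw [Category.assoc, reindex_map_fac, unitLift, Category.assoc]

lemma unitLift_homEquiv_symm {A : Fiber p W} {C : Fiber p Z} (g : A ⟶ (reindex p d).obj C) :
    unitLift adj A ≫ ((adj.homEquiv A C).symm g).1 = g.1 ≫ cartLift p d C := by
  rw [← homEquiv_fac, Equiv.apply_symm_apply]

lemma unitLift_naturality {A A' : Fiber p W} (g : A ⟶ A') :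
    unitLift adj A ≫ (L.map g).1 = g.1 ≫ unitLift adj A' := by
  have := congrArg Subtype.val (adj.unit.naturality g)
  change g.1 ≫ (adj.unit.app A').1 = (adj.unit.app A).1 ≫ ((reindex p d).map (L.map g)).1 at this
  rw [unitLift, unitLift, Category.assoc, ← reindex_map_fac, reassoc_of% this]

instance unitLift_isCocartesian (A : Fiber p W) : p.IsCocartesian d (unitLift adj A) where
  universal_property {C} φ hφ := by
    let C' : Fiber p Z := ⟨C, IsHomLift.codomain_eq p d φ⟩
    let g : A ⟶ (reindex p d).obj C' := reindexLift d φ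
    refine ⟨((adj.homEquiv A C').symm g).1, ⟨((adj.homEquiv A C').symm g).2, ?_⟩, ?_⟩
    · exact (unitLift_homEquiv_symm adj g).trans (reindexLift_fac (A := A) (A' := C') d φ)
    · rintro k ⟨hk, hk'⟩
      let k' : L.obj A ⟶ C' := ⟨k, hk⟩
      have : k' = (adj.homEquiv A C').symm g := by
        rw [Equiv.eq_symm_apply]
        refine reindex_hom_ext d ?_
        rw [homEquiv_fac]
        exact hk'.trans (reindexLift_fac (A := A) (A' := C') d φ).symm
      exact congrArg Subtype.val this

lemma isIso_of_isCocartesian_unitLift_comp {A : Fiber p W} {C : Fiber p Z} (b : L.obj A ⟶ C)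
    (h : p.IsCocartesian d (unitLift adj A ≫ b.1)) : IsIso b := by
  have : b.1 = (IsCocartesian.codomainUniqueUpToIso p d (unitLift adj A)
      (unitLift adj A ≫ b.1)).hom := IsCocartesian.map_uniq p d _ _ b.1 rfl
  have : IsIso b.1 := this ▸ inferInstance
  exact isIso_of_isIso_val b

lemma unitLift_beckChevalleyMap {W' Z' : B} {u : W ⟶ W'} {d' : W' ⟶ Z'} {v : Z ⟶ Z'}
    (h : u ≫ d' = d ≫ v) {L' : Fiber p W' ⥤ Fiber p Z'} (adj' : L' ⊣ reindex p d')
    (A : Fiber p W') :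
    (unitLift adj ((reindex p u).obj A) ≫ (beckChevalleyMap p h adj adj' A).1) ≫
      cartLift p v (L'.obj A) = cartLift p u A ≫ unitLift adj' A := by
  have h₁ := unitLift_homEquiv_symm adj (A := (reindex p u).obj A)
    ((reindex p u).map (adj'.unit.app A) ≫ reindexSquare p h (L'.obj A))
  have h₂ := reindexSquare_fac p h (L'.obj A)
  have h₃ := reindex_map_fac u (adj'.unit.app A)
  rw [beckChevalleyMap, h₁, Category.assoc]
  change (((reindex p u).map (adj'.unit.app A)).1 ≫ (reindexSquare p h (L'.obj A)).1) ≫ _ = _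
  rw [Category.assoc, h₂, reassoc_of% h₃]
  rfl

lemma unitLift_frobeniusMap_fst [HasFiniteProducts (Fiber p W)] [HasFiniteProducts (Fiber p Z)]
    (A : Fiber p W) (C : Fiber p Z) :
    (unitLift adj _ ≫ (frobeniusMap p adj A C).1) ≫ (prod.fst : C ⨯ L.obj A ⟶ C).1 =
      (prod.fst : (reindex p d).obj C ⨯ A ⟶ _).1 ≫ cartLift p d C := by
  have := congrArg Subtype.val
    (prod.lift_fst ((adj.homEquiv ((reindex p d).obj C ⨯ A) C).symm prod.fst) (L.map prod.snd))
  exact (Category.assoc _ _ _).trans ((congrArg (unitLift adj _ ≫ ·) this).trans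
    (unitLift_homEquiv_symm adj _))

lemma unitLift_frobeniusMap_snd [HasFiniteProducts (Fiber p W)] [HasFiniteProducts (Fiber p Z)]
    (A : Fiber p W) (C : Fiber p Z) :
    (unitLift adj _ ≫ (frobeniusMap p adj A C).1) ≫ (prod.snd : C ⨯ L.obj A ⟶ _).1 =
      (prod.snd : (reindex p d).obj C ⨯ A ⟶ A).1 ≫ unitLift adj A := by
  have := congrArg Subtype.val
    (prod.lift_snd ((adj.homEquiv ((reindex p d).obj C ⨯ A) C).symm prod.fst) (L.map prod.snd))
  exact (Category.assoc _ _ _).trans ((congrArg (unitLift adj _ ≫ ·) this).trans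
    (unitLift_naturality adj _))

end LeftAdjoints

/-! ### Fibred terminal objects -/

section FibredTerminal

variable {E : Type u₂} {B : Type u₁} [Category.{v₂} E] [Category.{v₁} B] {p : E ⥤ B}

lemma isHomLift_base_unique {X Y : B} {f g : X ⟶ Y} {A A' : E} (φ : A ⟶ A') [p.IsHomLift f φ]
    [p.IsHomLift g φ] : f = g := by
  rw [IsHomLift.fac p f φ, IsHomLift.fac p g φ]

lemma base_comp_eq {X Y Z : B} {f : X ⟶ Y} {g : Y ⟶ Z} {h : X ⟶ Z} {A A' A'' : E} {φ : A ⟶ A'}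
    {ψ : A' ⟶ A''} {χ : A ⟶ A''} [p.IsHomLift f φ] [p.IsHomLift g ψ] [p.IsHomLift h χ]
    (w : φ ≫ ψ = χ) : f ≫ g = h :=
  have : p.IsHomLift (f ≫ g) χ := w ▸ inferInstance
  isHomLift_base_unique (p := p) χ

lemma exists_isHomLift {X : B} {D : E} {A : Fiber p X} (φ : D ⟶ A.1) :
    ∃ f : p.obj D ⟶ X, p.IsHomLift f φ :=
  ⟨p.map φ ≫ eqToHom A.2, inferInstance⟩

lemma isHomLift_of_comp_vertical {W X : B} (f : W ⟶ X) {D : E} {A A' : Fiber p X} (l : D ⟶ A.1)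
    (π : A ⟶ A') {φ : D ⟶ A'.1} [hφ : p.IsHomLift f φ] (h : l ≫ π.1 = φ) : p.IsHomLift f l := by
  obtain rfl := IsHomLift.domain_eq p f φ
  obtain ⟨z, hz⟩ := exists_isHomLift l
  have : z ≫ 𝟙 X = f := base_comp_eq (p := p) h
  rwa [← this, Category.comp_id]

lemma isPullback_of_isPullback_base {X Y Z V : B} {f : X ⟶ Y} {g : X ⟶ Z} {h : Y ⟶ V} {k : Z ⟶ V}
    (H : IsPullback f g h k) {P : Fiber p X} {A : Fiber p Y} {A' : Fiber p Z} {C : Fiber p V}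
    {φ : P.1 ⟶ A.1} {ψ : P.1 ⟶ A'.1} {a : A.1 ⟶ C.1} {a' : A'.1 ⟶ C.1} [p.IsHomLift f φ]
    [p.IsHomLift g ψ] [p.IsHomLift h a] [p.IsHomLift k a'] (w : φ ≫ a = ψ ≫ a')
    (exists_lift : ∀ {D : E} (z : p.obj D ⟶ X) (x : D ⟶ A.1) (y : D ⟶ A'.1) [p.IsHomLift (z ≫ f) x]
      [p.IsHomLift (z ≫ g) y], x ≫ a = y ≫ a' →
        ∃ l : D ⟶ P.1, p.IsHomLift z l ∧ l ≫ φ = x ∧ l ≫ ψ = y)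
    (hom_ext : ∀ {D : E} (z : p.obj D ⟶ X) (l m : D ⟶ P.1) [p.IsHomLift z l] [p.IsHomLift z m],
      l ≫ φ = m ≫ φ → l ≫ ψ = m ≫ ψ → l = m) :
    IsPullback φ ψ a a' where
  w := w
  isLimit' := by
    have key (s : PullbackCone a a') : ∃ l : s.pt ⟶ P.1, (l ≫ φ = s.fst ∧ l ≫ ψ = s.snd) ∧
        ∀ m : s.pt ⟶ P.1, m ≫ φ = s.fst → m ≫ ψ = s.snd → m = l := by
      obtain ⟨x, hx⟩ := exists_isHomLift s.fst
      obtain ⟨y, hy⟩ := exists_isHomLift s.snd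
      have : p.IsHomLift (y ≫ k) (s.snd ≫ a') := inferInstance
      have hxy : x ≫ h = y ≫ k := base_comp_eq (p := p) s.condition
      obtain ⟨z, rfl, rfl⟩ : ∃ z, z ≫ f = x ∧ z ≫ g = y :=
        ⟨H.lift x y hxy, H.lift_fst _ _ _, H.lift_snd _ _ _⟩
      obtain ⟨l, hl, hl₁, hl₂⟩ := exists_lift z s.fst s.snd s.condition
      refine ⟨l, ⟨hl₁, hl₂⟩, fun m hm₁ hm₂ => ?_⟩
      obtain ⟨z', hz'⟩ := exists_isHomLift (A := P) m
      obtain rfl : z' = z := H.hom_ext (base_comp_eq (p := p) hm₁) (base_comp_eq (p := p) hm₂)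
      exact hom_ext z' m l (hm₁.trans hl₁.symm) (hm₂.trans hl₂.symm)
    choose l hl hl' using key
    exact ⟨PullbackCone.IsLimit.mk _ l (fun s => (hl s).1) (fun s => (hl s).2) hl'⟩

variable (p) in
/-- Fibred terminal objects of `p`: over each `X` an object `1_X` such that from every object over
`V` there is exactly one arrow to `1_X` over each `V ⟶ X`. For a fibration this says that the `1_X`
are terminal in their fibres and stable under reindexing. -/
structure FibredTerminal where
  obj (X : B) : Fiber p X
  lift {V X : B} (f : V ⟶ X) {D : E} (hD : p.obj D = V) : D ⟶ (obj X).1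
  lift_isHomLift {V X : B} (f : V ⟶ X) {D : E} (hD : p.obj D = V) : p.IsHomLift f (lift f hD)
  hom_ext {V X : B} (f : V ⟶ X) {D : E} (φ ψ : D ⟶ (obj X).1) [p.IsHomLift f φ]
    [p.IsHomLift f ψ] : φ = ψ

namespace FibredTerminal

attribute [instance] lift_isHomLift

variable (T : FibredTerminal p)

/-- The arrow `1_X ⟶ 1_Y` over `f : X ⟶ Y`. -/
def map {X Y : B} (f : X ⟶ Y) : (T.obj X).1 ⟶ (T.obj Y).1 :=
  T.lift f (T.obj X).2

instance map_isHomLift {X Y : B} (f : X ⟶ Y) : p.IsHomLift f (T.map f) :=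
  T.lift_isHomLift f (T.obj X).2

/-- The arrow `A ⟶ 1_X` in the fibre over `X`. -/
def toTerminal {X : B} (A : Fiber p X) : A ⟶ T.obj X :=
  ⟨T.lift (𝟙 X) A.2, inferInstance⟩

lemma comp_map_eq_comp_map {X Y Z V : B} {f : X ⟶ Y} {g : X ⟶ Z} {h : Y ⟶ V} {k : Z ⟶ V}
    (w : f ≫ h = g ≫ k) {D : E} (φ : D ⟶ (T.obj Y).1) (ψ : D ⟶ (T.obj Z).1) [p.IsHomLift f φ]
    [p.IsHomLift g ψ] : φ ≫ T.map h = ψ ≫ T.map k :=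
  have : p.IsHomLift (f ≫ h) (ψ ≫ T.map k) := w ▸ inferInstance
  T.hom_ext (f ≫ h) _ _

lemma comp_toTerminal {W X : B} (f : W ⟶ X) {D : E} {A : Fiber p X} (φ : D ⟶ A.1)
    (ψ : D ⟶ (T.obj X).1) [p.IsHomLift f φ] [p.IsHomLift f ψ] : φ ≫ (T.toTerminal A).1 = ψ :=
  T.hom_ext f _ _

lemma toTerminal_naturality {W X : B} (f : W ⟶ X) {A : Fiber p W} {A' : Fiber p X}
    (φ : A.1 ⟶ A'.1) [p.IsHomLift f φ] :
    φ ≫ (T.toTerminal A').1 = (T.toTerminal A).1 ≫ T.map f :=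
  T.comp_toTerminal f φ _

lemma isPullback_map {X Y Z V : B} {f : X ⟶ Y} {g : X ⟶ Z} {h : Y ⟶ V} {k : Z ⟶ V}
    (H : IsPullback f g h k) : IsPullback (T.map f) (T.map g) (T.map h) (T.map k) :=
  isPullback_of_isPullback_base H (T.comp_map_eq_comp_map H.w _ _)
    (fun z _ _ _ _ _ => ⟨T.lift z rfl, inferInstance, T.hom_ext (z ≫ f) _ _, T.hom_ext (z ≫ g) _ _⟩)
    fun z l m _ _ _ _ => T.hom_ext z l m

section Cartesian

variable {X Y : B} (t : X ⟶ Y) {A' : Fiber p X} {A : Fiber p Y} (φ : A'.1 ⟶ A.1)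

lemma isPullback_of_isStronglyCartesian [p.IsStronglyCartesian t φ] :
    IsPullback φ (T.toTerminal A').1 (T.toTerminal A).1 (T.map t) := by
  refine isPullback_of_isPullback_base (IsPullback.of_id_snd (f := t)) ?_
    (fun z x y _ hy _ => ?_) fun z l m _ _ h _ => IsStronglyCartesian.ext p t φ z h
  · exact T.comp_toTerminal t φ _
  · rw [Category.comp_id] at hy
    exact ⟨IsStronglyCartesian.map p t φ rfl x,
      IsStronglyCartesian.map_isHomLift p t φ rfl x, IsStronglyCartesian.fac p t φ rfl x,
      T.comp_toTerminal z _ y⟩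

lemma isStronglyCartesian_of_isPullback [p.IsHomLift t φ]
    (H : IsPullback φ (T.toTerminal A').1 (T.toTerminal A).1 (T.map t)) :
    p.IsStronglyCartesian t φ where
  universal_property' {D} g ψ hψ := by
    have w : ψ ≫ (T.toTerminal A).1 = T.lift g rfl ≫ T.map t := T.comp_toTerminal (g ≫ t) ψ _
    refine ⟨H.lift ψ (T.lift g rfl) w, ⟨?_, H.lift_fst _ _ _⟩, fun χ ⟨hχ, hχ'⟩ => ?_⟩
    · exact isHomLift_of_comp_vertical g _ (T.toTerminal A') (H.lift_snd _ _ w)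
    · exact H.hom_ext (hχ'.trans (H.lift_fst _ _ _).symm)
        ((T.comp_toTerminal g χ _).trans (H.lift_snd _ _ _).symm)

end Cartesian

lemma isLimit_of_isPullback {X : B} {P A C : Fiber p X} (π₁ : P ⟶ A) (π₂ : P ⟶ C)
    (H : IsPullback π₁.1 π₂.1 (T.toTerminal A).1 (T.toTerminal C).1) :
    Nonempty (IsLimit (BinaryFan.mk π₁ π₂)) := by
  have key {Q : Fiber p X} (f : Q ⟶ A) (g : Q ⟶ C) : ∃ l : Q ⟶ P, l ≫ π₁ = f ∧ l ≫ π₂ = g := by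
    have w : f.1 ≫ (T.toTerminal A).1 = g.1 ≫ (T.toTerminal C).1 :=
      (T.comp_toTerminal (𝟙 X) f.1 (T.toTerminal Q).1).trans
        (T.comp_toTerminal (𝟙 X) g.1 _).symm
    have hl : p.IsHomLift (𝟙 X) (H.lift f.1 g.1 w) :=
      isHomLift_of_comp_vertical (𝟙 X) _ π₁ (H.lift_fst _ _ w)
    exact ⟨⟨_, hl⟩, Subtype.ext (H.lift_fst _ _ _), Subtype.ext (H.lift_snd _ _ _)⟩
  choose l hl hl' using @key
  exact ⟨BinaryFan.IsLimit.mk _ l hl hl' fun f g m h₁ h₂ => Subtype.ext (H.hom_ext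
    (congrArg Subtype.val (h₁.trans (hl f g).symm))
    (congrArg Subtype.val (h₂.trans (hl' f g).symm)))⟩

section Reindexing

variable [p.IsFibered] {X Y : B} (f : X ⟶ Y)

lemma isPullback_cartLift (A : Fiber p Y) :
    IsPullback (cartLift p f A) (T.toTerminal ((reindex p f).obj A)).1 (T.toTerminal A).1
      (T.map f) :=
  T.isPullback_of_isStronglyCartesian f (cartLift p f A)

include T in
lemma isPullback_reindex_map {A A' : Fiber p Y} (g : A ⟶ A') :
    IsPullback (cartLift p f A) ((reindex p f).map g).1 g.1 (cartLift p f A') := by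
  refine .of_bot ?_ (reindex_map_fac f g).symm (T.isPullback_cartLift f A')
  have := T.isPullback_cartLift f A
  rwa [← T.comp_toTerminal (𝟙 Y) g.1 (T.toTerminal A).1,
    ← T.comp_toTerminal (𝟙 X) ((reindex p f).map g).1 (T.toTerminal _).1] at this

/-- The reindexed object `f^* 1_Y` is terminal in the fibre over `X`. -/
noncomputable def isTerminalReindexObj : IsTerminal ((reindex p f).obj (T.obj Y)) :=
  IsTerminal.ofUniqueHom (fun A => reindexLift f (T.lift f A.2)) fun _ _ =>
    reindex_hom_ext f (T.hom_ext f _ _)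

end Reindexing

/-- The object `1_X` is terminal in the fibre over `X`. -/
def isTerminalObj (X : B) : IsTerminal (T.obj X) :=
  IsTerminal.ofUniqueHom T.toTerminal fun _ _ => Subtype.ext (T.hom_ext (𝟙 X) _ _)

end FibredTerminal

/-- A functor is an isofibration if isomorphisms out of an object of the base lift to isomorphisms
out of any object above it. -/
def IsIsofibration (p : E ⥤ B) : Prop :=
  ∀ (A : E) {Y : B} (e : p.obj A ≅ Y), ∃ (A' : E) (φ : A ≅ A'), p.IsHomLift e.hom φ.hom

section Pullbacks

variable [HasPullbacks E] [PreservesLimitsOfShape WalkingCospan p]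

lemma exists_isPullback_over (hp : IsIsofibration p) {X Y : B} (t : X ⟶ Y) {A C : Fiber p Y}
    {A' : Fiber p X} (a : A ⟶ C) (b : A'.1 ⟶ C.1) [p.IsHomLift t b] :
    ∃ (P : Fiber p X) (k : P.1 ⟶ A.1) (π : P ⟶ A'), p.IsHomLift t k ∧
      IsPullback k π.1 a.1 b := by
  have hpb := (IsPullback.of_hasPullback a.1 b).map p
  have : IsIso (p.map a.1) := IsHomLift.fac' p (𝟙 Y) a.1 ▸ inferInstance
  have : IsIso (p.map (pullback.snd a.1 b)) := hpb.isIso_snd_of_isIso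
  let e : p.obj (pullback a.1 b) ≅ X := asIso (p.map (pullback.snd a.1 b)) ≪≫ eqToIso A'.2
  have : p.IsHomLift e.hom (pullback.snd a.1 b) :=
    inferInstanceAs (p.IsHomLift (p.map (pullback.snd a.1 b) ≫ eqToHom A'.2) _)
  obtain ⟨P, φ, hφ⟩ := hp _ e
  have hπ : p.IsHomLift (𝟙 X) (φ.inv ≫ pullback.snd a.1 b) := by
    rw [← e.inv_hom_id]
    infer_instance
  have H : IsPullback (φ.inv ≫ pullback.fst a.1 b) (φ.inv ≫ pullback.snd a.1 b) a.1 b :=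
    (IsPullback.of_hasPullback a.1 b).of_iso φ (Iso.refl _) (Iso.refl _) (Iso.refl _)
      (by simp) (by simp) (by simp) (by simp)
  have : p.IsHomLift t ((φ.inv ≫ pullback.snd a.1 b) ≫ b) := inferInstance
  exact ⟨⟨P, IsHomLift.codomain_eq p e.hom φ.hom⟩, _, ⟨_, hπ⟩,
    isHomLift_of_comp_vertical t _ a H.w, H⟩

variable (hp : IsIsofibration p) (T : FibredTerminal p)
include hp T

lemma isFibered_of_isIsofibration : p.IsFibered :=
  .of_exists_isStronglyCartesian fun A X t => by
    obtain ⟨P, φ, π, hφ, H⟩ := exists_isPullback_over hp t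
      (T.toTerminal (Fiber.mk (a := A) rfl)) (T.map t)
    obtain rfl : π = T.toTerminal P := T.isTerminalObj X |>.hom_ext _ _
    exact ⟨P.1, φ, T.isStronglyCartesian_of_isPullback t φ H⟩

lemma exists_isPullback_toTerminal {X : B} (A C : Fiber p X) : ∃ (P : Fiber p X) (π₁ : P ⟶ A)
    (π₂ : P ⟶ C), IsPullback π₁.1 π₂.1 (T.toTerminal A).1 (T.toTerminal C).1 := by
  obtain ⟨P, π₁, π₂, hπ₁, H⟩ := exists_isPullback_over hp (𝟙 X) (T.toTerminal A) (T.toTerminal C).1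
  exact ⟨P, ⟨π₁, hπ₁⟩, π₂, H⟩

lemma isPullback_of_isLimit {X : B} {P A C : Fiber p X} {π₁ : P ⟶ A} {π₂ : P ⟶ C}
    (h : IsLimit (BinaryFan.mk π₁ π₂)) :
    IsPullback π₁.1 π₂.1 (T.toTerminal A).1 (T.toTerminal C).1 := by
  obtain ⟨P', π₁', π₂', H⟩ := exists_isPullback_toTerminal hp T A C
  obtain ⟨h'⟩ := T.isLimit_of_isPullback π₁' π₂' H
  let e : P' ≅ P := h'.conePointUniqueUpToIso h
  have e₁ : e.hom ≫ π₁ = π₁' := h'.conePointUniqueUpToIso_hom_comp h ⟨.left⟩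
  have e₂ : e.hom ≫ π₂ = π₂' := h'.conePointUniqueUpToIso_hom_comp h ⟨.right⟩
  exact H.of_iso (Fiber.fiberInclusion.mapIso e) (Iso.refl _) (Iso.refl _) (Iso.refl _)
    ((Category.comp_id _).trans (congrArg Subtype.val e₁.symm))
    ((Category.comp_id _).trans (congrArg Subtype.val e₂.symm))
    ((Category.comp_id _).trans (Category.id_comp _).symm)
    ((Category.comp_id _).trans (Category.id_comp _).symm)

lemma hasFiniteProducts_fiber (X : B) : HasFiniteProducts (Fiber p X) := by
  have := (T.isTerminalObj X).hasTerminal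
  have {A C : Fiber p X} : HasLimit (pair A C) := by
    obtain ⟨P, π₁, π₂, H⟩ := exists_isPullback_toTerminal hp T A C
    exact ⟨⟨_, (T.isLimit_of_isPullback π₁ π₂ H).some⟩⟩
  have := hasBinaryProducts_of_hasLimit_pair (Fiber p X)
  exact hasFiniteProducts_of_has_binary_and_terminal

lemma hasFibredProducts [p.IsFibered] [CartesianMonoidalCategory B] : HasFibredProducts p where
  fibre := hasFiniteProducts_fiber hp T
  reindex {X Y} f := by
    have := hasFiniteProducts_fiber hp T Y
    have (A C : Fiber p Y) : PreservesLimit (pair A C) (reindex p f) := by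
      obtain ⟨P, π₁, π₂, H⟩ := exists_isPullback_toTerminal hp T A C
      have H' : IsPullback ((reindex p f).map π₁).1 ((reindex p f).map π₂).1
          (T.toTerminal ((reindex p f).obj A)).1 (T.toTerminal ((reindex p f).obj C)).1 := by
        have H₁ := (T.isPullback_reindex_map f π₁).paste_horiz H.flip
        rw [← reindex_map_fac, (T.isPullback_cartLift f A).w] at H₁
        exact (H₁.of_right (T.hom_ext (𝟙 X) _ _) (T.isPullback_cartLift f C)).flip
      exact preservesLimit_of_preserves_limit_cone (T.isLimit_of_isPullback π₁ π₂ H).some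
        ((isLimitMapConeBinaryFanEquiv _ _ _).symm (T.isLimit_of_isPullback _ _ H').some)
    have : PreservesLimitsOfShape (Discrete WalkingPair) (reindex p f) :=
      ⟨fun {K} => preservesLimit_of_iso_diagram _ (diagramIsoPair K).symm⟩
    have : PreservesLimit (Functor.empty.{0} (Fiber p Y)) (reindex p f) :=
      preservesLimit_of_preserves_limit_cone (T.isTerminalObj Y)
        ((isLimitMapConeEmptyConeEquiv _ _).symm (T.isTerminalReindexObj f))
    have := preservesLimitsOfShape_pempty_of_preservesTerminal (reindex p f)
    exact .of_preserves_binary_and_terminal _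

end Pullbacks

end FibredTerminal

/-! ### Path objects in an isofibration -/

section PathObjects

variable {E : Type u₂} {B : Type u₁} [Category.{v₂} E] [Category.{v₁} B] {p : E ⥤ B}
  [CartesianMonoidalCategory B]

/-- Path objects of `p`: for each `X` an object over `X ⊗ X` with an arrow from `1_X` over the
diagonal, such that every arrow over a graph `⟨1, P⟩` which is a pullback of this arrow is
cocartesian. -/
structure PathObjects (T : FibredTerminal p) where
  obj (X : B) : Fiber p (X ⊗ X)
  refl (X : B) : (T.obj X).1 ⟶ (obj X).1
  refl_isHomLift (X : B) : p.IsHomLift (lift (𝟙 X) (𝟙 X)) (refl X)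
  isCocartesian {W X : B} (P : W ⟶ X) {A : Fiber p W} {C : Fiber p (W ⊗ X)} (j : A.1 ⟶ C.1)
    (k : C.1 ⟶ (obj X).1) [p.IsHomLift (lift (𝟙 W) P) j] [p.IsHomLift (P ▷ X) k]
    (H : IsPullback j (T.lift P A.2) k (refl X)) : p.IsCocartesian (lift (𝟙 W) P) j

attribute [instance] PathObjects.refl_isHomLift

lemma isPullback_lift_id_whiskerRight {W W' X : B} {f : W ⟶ W'} {P : W ⟶ X} {P' : W' ⟶ X}
    (h : f ≫ P' = P) : IsPullback (lift (𝟙 W) P) f (f ▷ X) (lift (𝟙 W') P') where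
  w := by ext <;> simp [h]
  isLimit' := by
    have key (s : PullbackCone (f ▷ X) (lift (𝟙 W') P')) :
        (s.fst ≫ fst W X) ≫ f = s.snd ∧ s.fst ≫ snd W X = s.snd ≫ P' := by
      constructor
      · simpa using s.condition =≫ fst W' X
      · simpa using s.condition =≫ snd W' X
    refine ⟨PullbackCone.IsLimit.mk _ (fun s => s.fst ≫ fst W X) (fun s => ?_)
      (fun s => (key s).1) fun s m hm _ => by simp [← hm]⟩
    ext
    · simp
    · rw [Category.assoc, lift_snd, ← h, ← Category.assoc, (key s).1, (key s).2]

variable [HasPullbacks E] [PreservesLimitsOfShape WalkingCospan p] (hp : IsIsofibration p)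
  {T : FibredTerminal p} (I : PathObjects T)
include hp I

lemma exists_isPullback_refl {W X : B} (P : W ⟶ X) (A : Fiber p W) :
    ∃ (C : Fiber p (W ⊗ X)) (j : A.1 ⟶ C.1) (k : C.1 ⟶ (I.obj X).1),
      p.IsHomLift (lift (𝟙 W) P) j ∧ p.IsHomLift (P ▷ X) k ∧
        IsPullback j (T.lift P A.2) k (I.refl X) := by
  have hP := isPullback_lift_id_whiskerRight (Category.comp_id P)
  have hd : 𝟙 W = lift (𝟙 W) P ≫ fst W X := by simp
  have := isFibered_of_isIsofibration hp T
  let φ := cartLift p (fst W X) A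
  have : p.IsHomLift (𝟙 W) (𝟙 A.1) := IsHomLift.id A.2
  let s := IsStronglyCartesian.map p (fst W X) φ hd (𝟙 A.1)
  have hs : s ≫ φ = 𝟙 A.1 := IsStronglyCartesian.fac p (fst W X) φ hd (𝟙 A.1)
  let t := T.lift (P ▷ X) ((reindex p (fst W X)).obj A).2
  have ht : p.IsHomLift (P ▷ X) t := T.lift_isHomLift _ _
  obtain ⟨C, k, π, hk, H⟩ := exists_isPullback_over hp (P ▷ X) (T.toTerminal (I.obj X)) t
  have w : (T.lift P A.2 ≫ I.refl X) ≫ (T.toTerminal (I.obj X)).1 = s ≫ t :=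
    have : p.IsHomLift (P ≫ lift (𝟙 X) (𝟙 X)) (s ≫ t) := hP.w ▸ inferInstance
    T.comp_toTerminal (P ≫ lift (𝟙 X) (𝟙 X)) _ _
  let j : A.1 ⟶ C.1 := H.lift _ s w
  have hj : j ≫ π.1 = s := H.lift_snd _ _ _
  have hj' : p.IsHomLift (lift (𝟙 W) P) j := isHomLift_of_comp_vertical _ j π hj
  refine ⟨C, j, k, hj', hk, isPullback_of_isPullback_base hP (H.lift_fst _ _ _)
    (fun z x y _ _ h => ?_) fun z l m _ _ h _ => ?_⟩
  · have : p.IsHomLift z (x ≫ π.1 ≫ φ) := by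
      have : p.IsHomLift ((z ≫ lift (𝟙 W) P) ≫ fst W X) ((x ≫ π.1) ≫ φ) := inferInstance
      simpa using this
    refine ⟨x ≫ π.1 ≫ φ, this, H.hom_ext ?_ ?_, T.hom_ext (z ≫ P) _ _⟩
    · rw [Category.assoc, H.lift_fst, h, ← Category.assoc]
      exact congrArg (· ≫ I.refl X) (T.hom_ext (z ≫ P) _ _)
    · refine IsStronglyCartesian.ext p (fst W X) φ (z ≫ lift (𝟙 W) P) ?_
      simp only [Category.assoc, hj, hs, Category.comp_id]
  · simpa only [Category.assoc, reassoc_of% hj, hs, Category.comp_id] using h =≫ (π.1 ≫ φ)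

section

variable [p.IsFibered]

lemma exists_isPullback_unitLift {W X : B} (P : W ⟶ X) {L : Fiber p W ⥤ Fiber p (W ⊗ X)}
    (adj : L ⊣ reindex p (lift (𝟙 W) P)) (A : Fiber p W) :
    ∃ k : (L.obj A).1 ⟶ (I.obj X).1, p.IsHomLift (P ▷ X) k ∧
      IsPullback (unitLift adj A) (T.lift P A.2) k (I.refl X) := by
  obtain ⟨C, j, k, hj, hk, H⟩ := exists_isPullback_refl hp I P A
  have := I.isCocartesian P j k H
  let e := IsCocartesian.codomainUniqueUpToIso p (lift (𝟙 W) P) j (unitLift adj A)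
  have he : j ≫ e.hom = unitLift adj A := IsCocartesian.fac p (lift (𝟙 W) P) j (unitLift adj A)
  have : p.IsHomLift (𝟙 (W ⊗ X)) e.hom :=
    IsCocartesian.map_isHomLift p (lift (𝟙 W) P) j (unitLift adj A)
  refine ⟨e.inv ≫ k, inferInstance, H.of_iso (Iso.refl _) e (Iso.refl _) (Iso.refl _) ?_ ?_ ?_ ?_⟩
  · simpa using he
  all_goals simp

lemma isIso_of_isPullback_unitLift {W W' X : B} {f : W ⟶ W'} {P : W ⟶ X} {P' : W' ⟶ X}
    (h : f ≫ P' = P) {L : Fiber p W ⥤ Fiber p (W ⊗ X)} (adj : L ⊣ reindex p (lift (𝟙 W) P))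
    {L' : Fiber p W' ⥤ Fiber p (W' ⊗ X)} (adj' : L' ⊣ reindex p (lift (𝟙 W') P')) {A : Fiber p W}
    {A' : Fiber p W'} {C : Fiber p (W ⊗ X)} {b : L.obj A ⟶ C} {φ : A.1 ⟶ A'.1}
    {ψ : C.1 ⟶ (L'.obj A').1} [p.IsHomLift f φ] [p.IsHomLift (f ▷ X) ψ]
    (H : IsPullback (unitLift adj A ≫ b.1) φ ψ (unitLift adj' A')) : IsIso b := by
  subst h
  obtain ⟨k, hk, Hk⟩ := exists_isPullback_unitLift hp I P' adj' A'
  have : p.IsHomLift ((f ≫ P') ▷ X) (ψ ≫ k) := comp_whiskerRight f P' X ▸ inferInstance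
  have hφ : φ ≫ T.lift P' A'.2 = T.lift (f ≫ P') A.2 := T.hom_ext (f ≫ P') _ _
  exact isIso_of_isCocartesian_unitLift_comp adj b
    (I.isCocartesian (f ≫ P') _ (ψ ≫ k) (hφ ▸ H.paste_vert Hk))

lemma isIso_frobeniusMap {W X : B} (P : W ⟶ X) {L : Fiber p W ⥤ Fiber p (W ⊗ X)}
    [HasFiniteProducts (Fiber p W)] [HasFiniteProducts (Fiber p (W ⊗ X))]
    (adj : L ⊣ reindex p (lift (𝟙 W) P)) (A : Fiber p W) (C : Fiber p (W ⊗ X)) :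
    IsIso (frobeniusMap p adj A C) := by
  have hP := isPullback_of_isLimit hp T (prodIsProd ((reindex p (lift (𝟙 W) P)).obj C) A)
  have hQ := isPullback_of_isLimit hp T (prodIsProd C (L.obj A))
  have : p.IsHomLift (𝟙 W ▷ X) (prod.snd : C ⨯ L.obj A ⟶ L.obj A).1 := by
    rw [id_whiskerRight]
    exact fiberHom_isHomLift ..
  refine isIso_of_isPullback_unitLift hp I (Category.id_comp P) adj adj
    (φ := (prod.snd : (reindex p (lift (𝟙 W) P)).obj C ⨯ A ⟶ A).1)
    (ψ := (prod.snd : C ⨯ L.obj A ⟶ L.obj A).1) (.of_right ?_ ?_ hQ)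
  · have := hP.paste_horiz (T.isPullback_cartLift (lift (𝟙 W) P) C)
    rwa [← unitLift_frobeniusMap_fst adj A C,
      ← T.toTerminal_naturality (lift (𝟙 W) P) (unitLift adj A)] at this
  · exact unitLift_frobeniusMap_snd adj A C

lemma isIso_beckChevalleyMap {W W' X : B} {f : W ⟶ W'} {P : W ⟶ X} {P' : W' ⟶ X}
    (hf : f ≫ P' = P) (h : f ≫ lift (𝟙 W') P' = lift (𝟙 W) P ≫ (f ▷ X))
    {L : Fiber p W ⥤ Fiber p (W ⊗ X)} (adj : L ⊣ reindex p (lift (𝟙 W) P))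
    {L' : Fiber p W' ⥤ Fiber p (W' ⊗ X)} (adj' : L' ⊣ reindex p (lift (𝟙 W') P'))
    (A : Fiber p W') : IsIso (beckChevalleyMap p h adj adj' A) := by
  have hA := T.isPullback_cartLift f A
  have hL := T.isPullback_cartLift (f ▷ X) (L'.obj A)
  have hT := T.isPullback_map (isPullback_lift_id_whiskerRight hf)
  refine isIso_of_isPullback_unitLift hp I hf adj adj' (φ := cartLift p f A)
    (ψ := cartLift p (f ▷ X) (L'.obj A)) (.of_right ?_ ?_ hL.flip)
  · have := hA.flip.paste_horiz hT
    rwa [← T.toTerminal_naturality (lift (𝟙 W') P') (unitLift adj' A),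
      ← T.toTerminal_naturality (lift (𝟙 W) P) (unitLift adj ((reindex p f).obj A) ≫
        (beckChevalleyMap p h adj adj' A).1)] at this
  · exact unitLift_beckChevalleyMap adj h adj' A

end

theorem isElementaryFibration : IsElementaryFibration p := by
  have := isFibered_of_isIsofibration hp T
  have hprod := hasFibredProducts hp T
  have hadj (Y X : B) : (reindex p (parDiag Y X)).IsRightAdjoint :=
    reindex_isRightAdjoint fun A => by
      obtain ⟨C, j, k, hj, hk, H⟩ := exists_isPullback_refl hp I (snd Y X) A
      exact ⟨C, j, I.isCocartesian (snd Y X) j k H⟩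
  have := hprod.fibre
  exact ⟨inferInstance, hprod, _, fun Y X => Adjunction.ofIsRightAdjoint (reindex p (parDiag Y X)),
    fun Y X A C => isIso_frobeniusMap hp I (snd Y X) _ A C,
    fun Y Z f X A => isIso_beckChevalleyMap hp I (by simp) _ _ _ A⟩

end PathObjects

/-! ### Algebras as split cloven isofibrations -/

section Algebras

lemma preservesLimitsOfShape_rightFunc (J : Type*) [Category* J] {C : Type*} [Category* C]
    [HasLimitsOfShape J C] : PreservesLimitsOfShape J (Arrow.rightFunc : Arrow C ⥤ C) where
  preservesLimit {F} :=
    preservesLimit_of_preserves_limit_cone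
      (Comma.coneOfPreservesIsLimit F (limit.isLimit _) (limit.isLimit _)) (limit.isLimit _)

instance : HasPullbacks RAlg.{u} :=
  hasLimitsOfShape_of_hasLimitsOfShape_createsLimitsOfShape (Monad.forget rightMonad.{u})

instance : PreservesLimitsOfShape WalkingCospan algCod.{u} :=
  have := preservesLimitsOfShape_rightFunc WalkingCospan (C := Cat.{u, u})
  comp_preservesLimitsOfShape _ _

/-- The algebra structure on `X` obtained from an algebra along an isomorphism of its carrier
with `X`. -/
def algebraOfIso {C : Type*} [Category* C] {M : Monad C} (A : M.Algebra) {X : C} (i : A.A ≅ X) :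
    M.Algebra where
  A := X
  a := M.map i.inv ≫ A.a ≫ i.hom
  unit := by simp [← reassoc_of% M.η.naturality i.inv, A.unit_assoc]
  assoc := by
    have := M.μ.naturality i.inv
    simp [← reassoc_of% this, ← A.assoc_assoc]

/-- The isomorphism of algebras over `i` from `A` to `algebraOfIso A i`. -/
def isoAlgebraOfIso {C : Type*} [Category* C] {M : Monad C} (A : M.Algebra) {X : C}
    (i : A.A ≅ X) : A ≅ algebraOfIso A i :=
  Monad.Algebra.isoMk i ((M.toFunctor.mapIso i).hom_inv_id_assoc (A.a ≫ i.hom))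

lemma isIsofibration_algCod : IsIsofibration algCod.{u} := fun α Y e =>
  let i : α.A ≅ Arrow.mk (α.A.hom ≫ e.hom) := Arrow.isoMk (Iso.refl _) e
  ⟨algebraOfIso α i, isoAlgebraOfIso α i, IsHomLift.map algCod (isoAlgebraOfIso α i).hom⟩

/-- The functor underlying an algebra. -/
abbrev under (α : RAlg.{u}) : α.A.left ⥤ α.A.right := α.A.hom.toFunctor

/-- The action `M F ⥤ 𝒜` of an algebra on `F : 𝒜 ⥤ ℬ`, which sends `(A, x : B ≅ F A)` to the
source of the chosen lift of `x` to `A`. -/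
abbrev act (α : RAlg.{u}) : MObj (under α) ⥤ α.A.left := α.a.left.toFunctor

lemma mapFunctor_congr {𝒜 ℬ 𝒞 𝒟 : Type u} [Category.{u} 𝒜] [Category.{u} ℬ] [Category.{u} 𝒞]
    [Category.{u} 𝒟] {F : 𝒜 ⥤ ℬ} {G : 𝒞 ⥤ 𝒟} {H H' : 𝒜 ⥤ 𝒞} {K K' : ℬ ⥤ 𝒟} (hH : H = H')
    (hK : K = K') (h : F ⋙ K = H ⋙ G) (h' : F ⋙ K' = H' ⋙ G) :
    mapFunctor H K h = mapFunctor H' K' h' := by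
  subst hH hK
  rfl

lemma algebra_a_right (α : RAlg.{u}) : α.a.right = 𝟙 α.A.right :=
  (Category.id_comp _).symm.trans (congrArg CommaMorphism.right α.unit)

lemma act_comp_under (α : RAlg.{u}) : act α ⋙ under α = rightFactor (under α) := by
  have h := Arrow.w α.a
  rw [algebra_a_right] at h
  exact congrArg Cat.Hom.toFunctor h

lemma leftFactor_comp_act (α : RAlg.{u}) : leftFactor (under α) ⋙ act α = 𝟭 α.A.left :=
  congrArg (fun f => f.left.toFunctor) α.unit

lemma mapFunctor_act_comp_act (α : RAlg.{u}) :
    mapFunctor (F := rightFactor (under α)) (G := under α) (act α) (𝟭 α.A.right)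
      (act_comp_under α).symm ⋙ act α = mulFunctor (under α) ⋙ act α := by
  have h : mulFunctor (under α) ⋙ act α =
      mapFunctor (F := rightFactor (under α)) (act α) α.a.right.toFunctor
        (square_functor α.a) ⋙ act α :=
    congrArg (fun f => f.left.toFunctor) α.assoc
  rw [h]
  exact congrArg (· ⋙ act α) (mapFunctor_congr rfl
    (congrArg Cat.Hom.toFunctor (algebra_a_right α)).symm _ _)

lemma under_comp_right {α β : RAlg.{u}} (f : α ⟶ β) :
    under α ⋙ f.f.right.toFunctor = f.f.left.toFunctor ⋙ under β :=
  square_functor f.f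

lemma act_comp_left {α β : RAlg.{u}} (f : α ⟶ β) :
    act α ⋙ f.f.left.toFunctor =
      mapFunctor f.f.left.toFunctor f.f.right.toFunctor (under_comp_right f) ⋙ act β :=
  (congrArg (fun f => f.left.toFunctor) f.h).symm

/-- The algebra with underlying functor `F` and action `m`. -/
def mkAlg {𝒜 ℬ : Cat.{u, u}} (F : 𝒜 ⥤ ℬ) (m : MObj F ⥤ 𝒜) (hm : m ⋙ F = rightFactor F)
    (unit : leftFactor F ⋙ m = 𝟭 𝒜)
    (assoc : mapFunctor (F := rightFactor F) (G := F) m (𝟭 ℬ) hm.symm ⋙ m = mulFunctor F ⋙ m) :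
    RAlg.{u} where
  A := Arrow.mk F.toCatHom
  a := Arrow.homMk (m.toCatHom : Cat.of (MObj F) ⟶ 𝒜) (𝟙 ℬ) (Cat.ext hm)
  unit := Arrow.hom_ext _ _ (Cat.ext unit) rfl
  assoc := Arrow.hom_ext _ _ (Cat.ext assoc.symm) rfl

/-- The morphism of algebras given by a square of functors compatible with the actions. -/
def mkHom {α β : RAlg.{u}} (H : α.A.left ⥤ β.A.left) (K : α.A.right ⟶ β.A.right)
    (w : under α ⋙ K.toFunctor = H ⋙ under β)
    (h : mapFunctor H K.toFunctor w ⋙ act β = act α ⋙ H) : α ⟶ β where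
  f := Arrow.homMk H.toCatHom K (Cat.ext w.symm)
  h := Arrow.hom_ext _ _ (Cat.ext h) <| by
    change K ≫ β.a.right = α.a.right ≫ K
    rw [algebra_a_right, algebra_a_right]
    exact (Category.comp_id K).trans (Category.id_comp K).symm

lemma algHom_ext {α β : RAlg.{u}} {f g : α ⟶ β} (hl : f.f.left.toFunctor = g.f.left.toFunctor)
    (hr : f.f.right = g.f.right) : f = g :=
  Monad.Algebra.Hom.ext (Arrow.hom_ext _ _ (Cat.ext hl) hr)

lemma right_eq_of_isHomLift {α β : RAlg.{u}} (g : α.A.right ⟶ β.A.right) (f : α ⟶ β)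
    [h : algCod.IsHomLift g f] : f.f.right = g :=
  (@IsHomLift.eq_of_isHomLift _ _ _ _ algCod α β g f h).symm

end Algebras

section Cleavage

/-- The arrow `(x, id) : (A, x : B ≅ F A) ⟶ (A, id : F A ≅ F A)` of `M F`, natural in `(A, x)`. -/
def toLeftFactor {𝒜 ℬ : Type u} [Category.{u} 𝒜] [Category.{u} ℬ] (F : 𝒜 ⥤ ℬ) :
    𝟭 (MObj F) ⟶ srcFunctor F ⋙ leftFactor F where
  app P := ⟨P.iso.hom, 𝟙 _, by simp [leftFactor, srcFunctor]⟩
  naturality P Q f := MHom.ext f.w ((Category.comp_id _).trans (Category.id_comp _).symm)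

/- Arrows whose endpoints agree only propositionally are compared as objects of the arrow
category. -/

lemma arrowMk_comp_congr {C : Type*} [Category* C] {X Y Z X' Y' Z' : C} {f : X ⟶ Y} {g : Y ⟶ Z}
    {f' : X' ⟶ Y'} {g' : Y' ⟶ Z'} (hf : Arrow.mk f = Arrow.mk f')
    (hg : Arrow.mk g = Arrow.mk g') : Arrow.mk (f ≫ g) = Arrow.mk (f' ≫ g') := by
  cases hf
  cases hg
  rfl

lemma arrowMk_eq_of_comp_mono {C : Type*} [Category* C] {X Y Z X' Y' : C} {f : X ⟶ Y} {g : Y ⟶ Z}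
    {f' : X' ⟶ Y'} {g' : Y' ⟶ Z} [Mono g] (hg : Arrow.mk g = Arrow.mk g')
    (h : Arrow.mk (f ≫ g) = Arrow.mk (f' ≫ g')) : Arrow.mk f = Arrow.mk f' := by
  obtain rfl : Y = Y' := congrArg Comma.left hg
  obtain rfl : g = g' := (Arrow.mk_inj _ _).1 hg
  obtain rfl : X = X' := congrArg Comma.left h
  rw [(cancel_mono g).1 ((Arrow.mk_inj _ _).1 h)]

lemma arrowMk_inv_eq_id {C : Type*} [Category* C] {X Y Z : C} {e : X ≅ Y}
    (h : Arrow.mk e.hom = Arrow.mk (𝟙 Z)) : Arrow.mk e.inv = Arrow.mk (𝟙 Z) := by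
  obtain rfl : X = Z := congrArg Comma.left h
  obtain rfl : Y = X := congrArg Comma.right h
  obtain rfl : e = Iso.refl Y := Iso.ext ((Arrow.mk_inj _ _).1 h)
  rfl

lemma arrowMk_mkHom_congr {C D : Type*} [Category* C] [Category* D] {X X' Y Y' : C}
    {Z Z' W W' : D} {f : X ⟶ Y} {f' : X' ⟶ Y'} {g : Z ⟶ W} {g' : Z' ⟶ W'}
    (hf : Arrow.mk f = Arrow.mk f') (hg : Arrow.mk g = Arrow.mk g') :
    Arrow.mk (f ×ₘ g) = Arrow.mk (f' ×ₘ g') := by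
  cases hf
  cases hg
  rfl

section

variable {𝒜 ℬ 𝒞 𝒟 : Type u} [Category.{u} 𝒜] [Category.{u} ℬ] [Category.{u} 𝒞] [Category.{u} 𝒟]
  {F : 𝒜 ⥤ ℬ} {G : 𝒞 ⥤ 𝒟}

lemma arrowMk_eq {P Q P' Q' : MObj F} {f : P ⟶ Q} {g : P' ⟶ Q'} (hP : P = P') (hQ : Q = Q')
    (hb : f.b ≍ g.b) (ha : f.a ≍ g.a) : Arrow.mk f = Arrow.mk g := by
  have := MHom.heq hP hQ f g hb ha
  subst hP hQ
  rw [eq_of_heq this]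

instance (P : MObj F) : IsIso ((toLeftFactor F).app P) :=
  ⟨⟨P.iso.inv, 𝟙 _, by simp [leftFactor, srcFunctor]⟩,
    MHom.ext P.iso.hom_inv_id (Category.id_comp _), MHom.ext P.iso.inv_hom_id (Category.id_comp _)⟩

lemma arrowMk_mapFunctor_toLeftFactor (H : 𝒜 ⥤ 𝒞) (K : ℬ ⥤ 𝒟) (h : F ⋙ K = H ⋙ G) (P : MObj F) :
    Arrow.mk ((mapFunctor H K h).map ((toLeftFactor F).app P)) =
      Arrow.mk ((toLeftFactor G).app ((mapFunctor H K h).obj P)) := by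
  refine arrowMk_eq rfl (Functor.congr_obj (leftFactor_naturality H K h) P.src).symm ?_
    (heq_of_eq (H.map_id _))
  change K.map P.iso.hom ≍ K.map P.iso.hom ≫ (eqToHom h).app P.src
  rw [eqToHom_app]
  exact (comp_eqToHom_heq _ _).symm

/-- The arrow `(x', id) : (A, x x' : B' ≅ F A) ⟶ (A, x : B ≅ F A)` of `M F`. -/
def mulToSrc (P : MObj (rightFactor F)) : (mulFunctor F).obj P ⟶ P.src :=
  ⟨P.iso.hom, 𝟙 _,
    ((congrArg (P.iso.hom ≫ P.src.iso.hom ≫ ·) (F.map_id _)).trans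
      (congrArg (P.iso.hom ≫ ·) (Category.comp_id _))).symm.trans (Category.assoc _ _ _).symm⟩

lemma arrowMk_mulFunctor_toLeftFactor (P : MObj (rightFactor F)) :
    Arrow.mk ((mulFunctor F).map ((toLeftFactor _).app P)) = Arrow.mk (mulToSrc P) :=
  arrowMk_eq rfl (Functor.congr_obj (mulFunctor_left_unit F) P.src) HEq.rfl HEq.rfl

lemma mulToSrc_comp_toLeftFactor (P : MObj (rightFactor F)) :
    mulToSrc P ≫ (toLeftFactor F).app P.src = (toLeftFactor F).app ((mulFunctor F).obj P) :=
  MHom.ext rfl (Category.comp_id _)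

end

/-- The lift `act α P ⟶ A` of `x : B ≅ F A` chosen by an algebra on `F`, natural in
`P = (A, x)`. -/
def chosenLift (α : RAlg.{u}) : act α ⟶ srcFunctor (under α) :=
  whiskerRight (toLeftFactor (under α)) (act α) ≫
    eqToHom (congrArg (srcFunctor (under α) ⋙ ·) (leftFactor_comp_act α))

/-- The cleavage of an algebra: the arrows that are chosen lifts of isomorphisms. -/
def cleavage (α : RAlg.{u}) : MorphismProperty α.A.left :=
  MorphismProperty.ofHoms (chosenLift α).app

variable {α β : RAlg.{u}}

lemma arrowMk_chosenLift (P : MObj (under α)) :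
    Arrow.mk ((chosenLift α).app P) = Arrow.mk ((act α).map ((toLeftFactor (under α)).app P)) :=
  (congrArg (fun f => Arrow.mk ((act α).map ((toLeftFactor (under α)).app P) ≫ f))
    (eqToHom_app (congrArg (srcFunctor (under α) ⋙ ·) (leftFactor_comp_act α)) P)).trans
    (Arrow.arrow_mk_comp_eqToHom _ _)

lemma arrowMk_under_chosenLift (P : MObj (under α)) :
    Arrow.mk ((under α).map ((chosenLift α).app P)) = Arrow.mk P.iso.hom :=
  (congrArg (under α).mapArrow.obj (arrowMk_chosenLift P)).trans
    (congrArg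
      (fun H : MObj (under α) ⥤ α.A.right => H.mapArrow.obj (Arrow.mk ((toLeftFactor _).app P)))
      (act_comp_under α))

lemma chosenLift_mem_cleavage (P : MObj (under α)) : cleavage α ((chosenLift α).app P) := ⟨P⟩

lemma cleavage_le_isomorphisms : cleavage α ≤ MorphismProperty.isomorphisms α.A.left := by
  rintro _ _ _ ⟨P⟩
  refine ((MorphismProperty.isomorphisms _).arrow_mk_iso_iff
    (eqToIso (arrowMk_chosenLift P))).2 ?_
  exact inferInstanceAs (IsIso ((act α).map ((toLeftFactor (under α)).app P)))

lemma arrowMk_eq_of_cleavage {A A₁ A₂ : α.A.left} {f₁ : A₁ ⟶ A} {f₂ : A₂ ⟶ A}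
    (h₁ : cleavage α f₁) (h₂ : cleavage α f₂)
    (h : Arrow.mk ((under α).map f₁) = Arrow.mk ((under α).map f₂)) :
    Arrow.mk f₁ = Arrow.mk f₂ := by
  obtain ⟨⟨a₁, b₁, x₁⟩⟩ := h₁
  obtain ⟨⟨a₂, b₂, x₂⟩, e₂⟩ := (MorphismProperty.ofHoms_iff _ _).1 h₂
  obtain rfl : a₁ = a₂ := congrArg Comma.right e₂
  have e : Arrow.mk x₁.hom = Arrow.mk x₂.hom := by
    rw [← arrowMk_under_chosenLift ⟨_, b₁, x₁⟩, ← arrowMk_under_chosenLift ⟨_, b₂, x₂⟩]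
    exact h.trans (congrArg (under α).mapArrow.obj e₂)
  obtain rfl : b₁ = b₂ := congrArg Comma.left e
  obtain rfl : x₁ = x₂ := Iso.ext ((Arrow.mk_inj _ _).1 e)
  exact e₂.symm

lemma exists_mapFunctor_act_obj_eq (P Q : MObj (under α)) (h : Q.src = (act α).obj P) :
    ∃ P' : MObj (rightFactor (under α)), P'.src = P ∧
      (mapFunctor (F := rightFactor (under α)) (G := under α) (act α) (𝟭 α.A.right)
        (act_comp_under α).symm).obj P' = Q := by
  have e : (under α).obj Q.src = P.pt := by
    rw [h]
    exact Functor.congr_obj (act_comp_under α) P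
  refine ⟨⟨P, Q.pt, Q.iso ≪≫ eqToIso e⟩, rfl, MObj.ext' h.symm rfl ?_⟩
  change (Q.iso.hom ≫ eqToHom e) ≫ (eqToHom (act_comp_under α).symm).app P = _
  rw [eqToHom_app]
  exact (Category.assoc _ _ _).trans
    ((congrArg (Q.iso.hom ≫ ·) (eqToHom_trans _ _)).trans (Category.id_comp _).symm)

lemma arrowMk_chosenLift_mapFunctor_act (P : MObj (rightFactor (under α))) :
    Arrow.mk ((chosenLift α).app ((mapFunctor (F := rightFactor (under α)) (G := under α) (act α)
      (𝟭 α.A.right) (act_comp_under α).symm).obj P)) = Arrow.mk ((act α).map (mulToSrc P)) :=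
  (arrowMk_chosenLift _).trans <|
    (congrArg (act α).mapArrow.obj (arrowMk_mapFunctor_toLeftFactor _ _ _ P)).symm.trans <|
    (congrArg (fun H : MObj _ ⥤ α.A.left => H.mapArrow.obj (Arrow.mk ((toLeftFactor _).app P)))
      (mapFunctor_act_comp_act α)).trans
    (congrArg (act α).mapArrow.obj (arrowMk_mulFunctor_toLeftFactor P))

instance : (cleavage α).IsMultiplicative where
  id_mem A := by
    refine (MorphismProperty.ofHoms_iff _ _).2 ⟨(leftFactor (under α)).obj A, ?_⟩
    rw [arrowMk_chosenLift]
    exact (congrArg (fun A => Arrow.mk (𝟙 A))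
      (Functor.congr_obj (leftFactor_comp_act α) A).symm).trans
        (congrArg Arrow.mk ((act α).map_id _).symm)
  comp_mem {A₁ A₂ A₃} g f hg hf := by
    obtain ⟨Q, hg⟩ := (MorphismProperty.ofHoms_iff _ g).1 hg
    obtain ⟨P⟩ := hf
    obtain ⟨P', rfl, rfl⟩ := exists_mapFunctor_act_obj_eq P Q (congrArg Comma.right hg).symm
    refine (MorphismProperty.ofHoms_iff _ _).2 ⟨(mulFunctor _).obj P', ?_⟩
    rw [arrowMk_comp_congr (hg.trans (arrowMk_chosenLift_mapFunctor_act P')) (arrowMk_chosenLift _),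
      arrowMk_chosenLift]
    exact congrArg Arrow.mk (((act α).map_comp _ _).symm.trans
      (congrArg (act α).map (mulToSrc_comp_toLeftFactor P')))

instance : (cleavage α).HasOfPostcompProperty (cleavage α) where
  of_postcomp {A₁ A₂ A₃} f g hg hfg := by
    have := cleavage_le_isomorphisms _ hg
    have := cleavage_le_isomorphisms _ hfg
    have := IsIso.of_isIso_comp_right f g
    let P : MObj (under α) := ⟨_, _, (under α).mapIso (asIso f)⟩
    refine (MorphismProperty.ofHoms_iff _ _).2 ⟨P, arrowMk_eq_of_comp_mono rfl (g' := g) ?_⟩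
    refine arrowMk_eq_of_cleavage hfg ((cleavage α).comp_mem _ _ (chosenLift_mem_cleavage P) hg) ?_
    rw [Functor.map_comp, (under α).map_comp ((chosenLift α).app P) g]
    exact arrowMk_comp_congr (arrowMk_under_chosenLift P).symm rfl

lemma cleavage_map {f : α ⟶ β} {A A' : α.A.left} {a : A' ⟶ A} (h : cleavage α a) :
    cleavage β (f.f.left.toFunctor.map a) := by
  obtain ⟨P⟩ := h
  refine (MorphismProperty.ofHoms_iff _ _).2
    ⟨(mapFunctor _ _ (under_comp_right f)).obj P, ?_⟩
  rw [arrowMk_chosenLift]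
  exact (congrArg f.f.left.toFunctor.mapArrow.obj (arrowMk_chosenLift P)).trans <|
    (congrArg (fun H : MObj _ ⥤ β.A.left => H.mapArrow.obj (Arrow.mk ((toLeftFactor _).app P)))
      (act_comp_left f)).trans <|
    congrArg (act β).mapArrow.obj (arrowMk_mapFunctor_toLeftFactor _ _ _ P)

/-- A cleavage transformation is a natural transformation all of whose components are chosen
lifts. -/
def IsCleavageTrans {𝒟 : Type*} [Category* 𝒟] {U V : 𝒟 ⥤ α.A.left} (φ : U ⟶ V) : Prop :=
  ∀ d, cleavage α (φ.app d)

lemma eq_of_isCleavageTrans {𝒟 : Type*} [Category* 𝒟] {U U' V V' : 𝒟 ⥤ α.A.left} {φ : U ⟶ V}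
    {φ' : U' ⟶ V'} (hφ : IsCleavageTrans φ) (hφ' : IsCleavageTrans φ') (hV : V = V')
    (h : ∀ d, Arrow.mk ((under α).map (φ.app d)) = Arrow.mk ((under α).map (φ'.app d))) :
    U = U' := by
  subst hV
  have e d : Arrow.mk (φ.app d) = Arrow.mk (φ'.app d) :=
    arrowMk_eq_of_cleavage (hφ d) (hφ' d) (h d)
  have isIso_app (d) : IsIso (φ.app d) := cleavage_le_isomorphisms _ (hφ d)
  refine Arrow.functor_ext fun c d f =>
    arrowMk_eq_of_comp_mono (f := U.map f) (f' := U'.map f) (e d) ?_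
  rw [φ.naturality, φ'.naturality]
  exact arrowMk_comp_congr (e c) rfl

/-- The functor into `M F` given by a family of isomorphisms `x_d : K d ≅ F (V d)`. -/
def toMObj {𝒟 : Type*} [Category* 𝒟] {𝒜 ℬ : Type u} [Category.{u} 𝒜] [Category.{u} ℬ] {F : 𝒜 ⥤ ℬ}
    {K : 𝒟 ⥤ ℬ} {V : 𝒟 ⥤ 𝒜} (ω : K ≅ V ⋙ F) : 𝒟 ⥤ MObj F where
  obj d := ⟨V.obj d, K.obj d, ω.app d⟩
  map f := ⟨K.map f, V.map f, ω.hom.naturality f⟩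
  map_id _ := MHom.ext (K.map_id _) (V.map_id _)
  map_comp _ _ := MHom.ext (K.map_comp _ _) (V.map_comp _ _)

lemma exists_isCleavageTrans {𝒟 : Type*} [Category* 𝒟] {K : 𝒟 ⥤ α.A.right} {V : 𝒟 ⥤ α.A.left}
    (ω : K ≅ V ⋙ under α) :
    ∃ (U : 𝒟 ⥤ α.A.left) (φ : U ⟶ V), U ⋙ under α = K ∧ IsCleavageTrans φ ∧
      ∀ d, Arrow.mk ((under α).map (φ.app d)) = Arrow.mk (ω.hom.app d) :=
  ⟨toMObj ω ⋙ act α, whiskerLeft (toMObj ω) (chosenLift α),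
    congrArg (toMObj ω ⋙ ·) (act_comp_under α), fun _ => chosenLift_mem_cleavage _,
    fun _ => arrowMk_under_chosenLift _⟩

/-- The morphism of algebras given by a square of functors that preserves chosen lifts. -/
def homOfCleavage (H : α.A.left ⥤ β.A.left) (K : α.A.right ⟶ β.A.right)
    (w : under α ⋙ K.toFunctor = H ⋙ under β)
    (h : cleavage α ≤ (cleavage β).inverseImage H) : α ⟶ β :=
  mkHom H K w <| eq_of_isCleavageTrans (V := srcFunctor (under α) ⋙ H)
    (φ := whiskerLeft (mapFunctor H K.toFunctor w) (chosenLift β))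
    (φ' := whiskerRight (chosenLift α) H)
    (fun _ => chosenLift_mem_cleavage _) (fun _ => h _ (chosenLift_mem_cleavage _)) rfl fun P => by
      refine (arrowMk_under_chosenLift _).trans <| Eq.trans ?_ <|
        (congrArg K.toFunctor.mapArrow.obj (arrowMk_under_chosenLift P)).symm.trans <|
        congrArg (fun G : α.A.left ⥤ β.A.right => G.mapArrow.obj (Arrow.mk ((chosenLift α).app P)))
          w
      exact (congrArg (fun f => Arrow.mk (K.toFunctor.map P.iso.hom ≫ f))
        (eqToHom_app w P.src)).trans (Arrow.arrow_mk_comp_eqToHom _ _)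

lemma exists_hom_isCleavageTrans (m : α ⟶ β) (N : α.A.right ⟶ β.A.right)
    (ω : under α ⋙ N.toFunctor ≅ m.f.left.toFunctor ⋙ under β) :
    ∃ (m' : α ⟶ β) (φ : m'.f.left.toFunctor ⟶ m.f.left.toFunctor), m'.f.right = N ∧
      IsCleavageTrans φ ∧ ∀ d, Arrow.mk ((under β).map (φ.app d)) = Arrow.mk (ω.hom.app d) := by
  obtain ⟨U, φ, hU, hφ, hω⟩ := exists_isCleavageTrans ω
  refine ⟨homOfCleavage U N hU.symm fun A A' f hf => ?_, φ, rfl, hφ, hω⟩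
  refine (cleavage β).of_postcomp _ _ (hφ A') ?_
  rw [φ.naturality]
  exact (cleavage β).comp_mem _ _ (hφ A) (cleavage_map hf)

end Cleavage

/-! ### Algebras of isomorphisms -/

section IsomorphismAlgebra

/-- The algebra on the identity functor of `X`, which is terminal in the fibre over `X`. -/
def idAlg (X : Cat.{u, u}) : RAlg.{u} :=
  mkAlg (𝟭 X) (rightFactor (𝟭 X)) rfl rfl rfl

/-- The morphism to the algebra on the identity functor of `X` given by a functor to `X`. -/
def toIdAlg (α : RAlg.{u}) {X : Cat.{u, u}} (f : α.A.right ⟶ X) : α ⟶ idAlg X :=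
  mkHom (under α ⋙ f.toFunctor) f rfl (congrArg (· ⋙ f.toFunctor) (act_comp_under α)).symm

lemma hom_idAlg_ext {α : RAlg.{u}} {X : Cat.{u, u}} {f g : α ⟶ idAlg X}
    (h : f.f.right = g.f.right) : f = g :=
  algHom_ext ((under_comp_right f).symm.trans
    ((congrArg (fun K => under α ⋙ K.toFunctor) h).trans (under_comp_right g))) h

/-- The fibred terminal object of `algCod`, given by the algebras on identity functors. -/
def fibredTerminal : FibredTerminal algCod.{u} where
  obj X := ⟨idAlg X, rfl⟩
  lift f D hD := toIdAlg D (eqToHom hD ≫ f)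
  lift_isHomLift f D hD := by
    subst hD
    refine IsHomLift.of_fac _ _ _ rfl rfl ?_
    change f = 𝟙 _ ≫ (𝟙 _ ≫ f) ≫ 𝟙 _
    simp only [Category.id_comp, Category.comp_id]
  hom_ext {V X} f D φ ψ hφ hψ := by
    obtain rfl := IsHomLift.domain_eq algCod f φ
    exact hom_idAlg_ext ((right_eq_of_isHomLift (β := idAlg X) f φ (h := hφ)).trans
      (right_eq_of_isHomLift (β := idAlg X) f ψ (h := hψ)).symm)

section

variable (𝒳 : Type u) [Category.{u} 𝒳]

/-- The functor `(src, pt) : M (𝟭 𝒳) ⥤ 𝒳 × 𝒳`, which sends `x : B ≅ A` to `(A, B)`. -/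
abbrev endpoints : MObj (𝟭 𝒳) ⥤ 𝒳 × 𝒳 :=
  (srcFunctor (𝟭 𝒳)).prod' (rightFactor (𝟭 𝒳))

/-- The lifting of isomorphisms along `endpoints 𝒳` by conjugation. -/
def conj : MObj (endpoints 𝒳) ⥤ MObj (𝟭 𝒳) where
  obj P := ⟨P.pt.1, P.pt.2, (CategoryTheory.Prod.snd 𝒳 𝒳).mapIso P.iso ≪≫ P.src.iso ≪≫
    ((CategoryTheory.Prod.fst 𝒳 𝒳).mapIso P.iso).symm⟩
  map {P Q} f := ⟨f.b.2, f.b.1, by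
    have h₁ : CommSq P.iso.hom.1 f.b.1 f.a.a Q.iso.hom.1 := ⟨(congrArg Prod.fst f.w).symm⟩
    have h₂ : CommSq P.iso.hom.2 f.b.2 f.a.b Q.iso.hom.2 := ⟨(congrArg Prod.snd f.w).symm⟩
    have h : CommSq P.src.iso.hom f.a.b f.a.a Q.src.iso.hom := ⟨f.a.w.symm⟩
    have h₁' := CommSq.horiz_inv (f := (CategoryTheory.Prod.fst 𝒳 𝒳).mapIso P.iso)
      (i := (CategoryTheory.Prod.fst 𝒳 𝒳).mapIso Q.iso) (g := f.b.1) (h := f.a.a) h₁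
    exact (h₂.horiz_comp (h.horiz_comp h₁')).w.symm⟩

lemma leftFactor_comp_conj : leftFactor (endpoints 𝒳) ⋙ conj 𝒳 = 𝟭 _ :=
  functor_ext_to_M rfl rfl fun P => by
    change 𝟙 P.pt ≫ P.iso.hom ≫ 𝟙 P.src = 𝟙 _ ≫ P.iso.hom ≫ 𝟙 _
    rfl

lemma mapFunctor_conj_comp_conj :
    mapFunctor (F := rightFactor (endpoints 𝒳)) (G := endpoints 𝒳) (conj 𝒳) (𝟭 _) rfl ⋙ conj 𝒳 =
      mulFunctor (endpoints 𝒳) ⋙ conj 𝒳 :=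
  functor_ext_to_M rfl rfl fun P => by
    have assoc {A₀ A₁ A₂ A₃ A₄ A₅ : 𝒳} (f₁ : A₀ ⟶ A₁) (f₂ : A₁ ⟶ A₂) (f₃ : A₂ ⟶ A₃)
        (f₄ : A₃ ⟶ A₄) (f₅ : A₄ ⟶ A₅) : (f₁ ≫ 𝟙 _) ≫ (f₂ ≫ f₃ ≫ f₄) ≫ 𝟙 _ ≫ f₅ =
          𝟙 _ ≫ ((f₁ ≫ f₂) ≫ f₃ ≫ f₄ ≫ f₅) ≫ 𝟙 _ := by
      simp only [Category.assoc, Category.id_comp, Category.comp_id]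
    exact assoc P.iso.hom.2 P.src.iso.hom.2 P.src.src.iso.hom P.src.iso.inv.1 P.iso.inv.1

lemma mapFunctor_leftFactor_comp_conj :
    mapFunctor (F := 𝟭 𝒳) (G := endpoints 𝒳) (leftFactor (𝟭 𝒳)) ((𝟭 𝒳).prod' (𝟭 𝒳)) rfl ⋙ conj 𝒳 =
      rightFactor (𝟭 𝒳) ⋙ leftFactor (𝟭 𝒳) :=
  functor_ext_to_M rfl rfl fun P => by
    have cancel {A B : 𝒳} (x : A ≅ B) :
        (x.hom ≫ 𝟙 _) ≫ 𝟙 _ ≫ 𝟙 _ ≫ x.inv = 𝟙 _ ≫ 𝟙 _ ≫ 𝟙 _ := by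
      simp only [Category.id_comp, Category.comp_id, Iso.hom_inv_id]
    exact cancel P.iso

end

/-- The algebra of isomorphisms of `X`, with underlying functor `endpoints X`. -/
def pathAlg (X : Cat.{u, u}) : RAlg.{u} :=
  mkAlg (𝒜 := Cat.of (MObj (𝟭 X))) (ℬ := X ⊗ X) (endpoints X) (conj X) rfl
    (leftFactor_comp_conj X) (mapFunctor_conj_comp_conj X)

/-- The morphism over the diagonal of `X` that sends an object to its identity. -/
def reflHom (X : Cat.{u, u}) : idAlg X ⟶ pathAlg X :=
  mkHom (leftFactor (𝟭 X)) (lift (𝟙 X) (𝟙 X)) rfl (mapFunctor_leftFactor_comp_conj X)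

end IsomorphismAlgebra

section Cocartesian

variable {α β γ : RAlg.{u}}

lemma IsCleavageTrans.isIso {𝒟 : Type*} [Category* 𝒟] {U V : 𝒟 ⥤ α.A.left} {φ : U ⟶ V}
    (hφ : IsCleavageTrans φ) : IsIso φ :=
  have _ (d) : IsIso (φ.app d) := cleavage_le_isomorphisms _ (hφ d)
  NatIso.isIso_of_isIso_app φ

lemma IsCleavageTrans.inv {𝒟 : Type*} [Category* 𝒟] {U V : 𝒟 ⥤ α.A.left} {φ : U ⟶ V} [IsIso φ]
    (hφ : IsCleavageTrans φ) : IsCleavageTrans (inv φ) := fun d => by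
  refine (cleavage α).of_postcomp _ _ (hφ d) ?_
  rw [← NatTrans.comp_app, IsIso.inv_hom_id]
  exact (cleavage α).id_mem _

lemma hom_ext_of_retraction {j : α ⟶ γ} {r : γ ⟶ α} {φ : 𝟭 γ.A.left ⟶ (r ≫ j).f.left.toFunctor}
    (hφ : IsCleavageTrans φ) {f g : γ ⟶ β} (hr : f.f.right = g.f.right) (h : j ≫ f = j ≫ g) :
    f = g := by
  refine algHom_ext (eq_of_isCleavageTrans
    (φ := whiskerRight φ f.f.left.toFunctor) (φ' := whiskerRight φ g.f.left.toFunctor)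
    (fun d => cleavage_map (hφ d)) (fun d => cleavage_map (hφ d)) ?_ fun d => ?_) hr
  · exact congrArg (fun f => (r ≫ f).f.left.toFunctor) h
  · have e : f.f.left.toFunctor ⋙ under β = g.f.left.toFunctor ⋙ under β :=
      (under_comp_right f).symm.trans <|
        (congrArg (under γ ⋙ ·.toFunctor) hr).trans (under_comp_right g)
    exact congrArg (fun H : γ.A.left ⥤ β.A.right => H.mapArrow.obj (Arrow.mk (φ.app d))) e

lemma exists_hom_comp_eq_of_retraction {j : α ⟶ γ} {r : γ ⟶ α} (hr : j ≫ r = 𝟙 α)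
    {φ : 𝟭 γ.A.left ⟶ (r ≫ j).f.left.toFunctor} (hφ : IsCleavageTrans φ)
    (hj : ∀ a, Arrow.mk ((under γ).map (φ.app (j.f.left.toFunctor.obj a))) =
      Arrow.mk (𝟙 ((under γ).obj (j.f.left.toFunctor.obj a))))
    (N : γ.A.right ⟶ β.A.right) (f : α ⟶ β) (hN : f.f.right = j.f.right ≫ N) :
    ∃ χ : γ ⟶ β, χ.f.right = N ∧ j ≫ χ = f := by
  have := hφ.isIso
  have h : (r ≫ j).f.left.toFunctor ⋙ under γ ⋙ N.toFunctor =
      (r ≫ f).f.left.toFunctor ⋙ under β :=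
    (congrArg (· ⋙ N.toFunctor) (under_comp_right (r ≫ j)).symm).trans <|
      (congrArg (fun K : α.A.right ⟶ β.A.right => under γ ⋙ r.f.right.toFunctor ⋙ K.toFunctor)
        hN.symm).trans (under_comp_right (r ≫ f))
  obtain ⟨χ, ψ, hχ, hψ, hω⟩ := exists_hom_isCleavageTrans (r ≫ f) N
    (isoWhiskerRight (asIso φ) (under γ ⋙ N.toFunctor) ≪≫ eqToIso h)
  have hψ_map (e) : Arrow.mk ((under β).map (ψ.app e)) =
      Arrow.mk (N.toFunctor.map ((under γ).map (φ.app e))) :=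
    (hω e).trans <|
      (congrArg (fun f => Arrow.mk (N.toFunctor.map ((under γ).map (φ.app e)) ≫ f))
        (eqToHom_app h e)).trans (Arrow.arrow_mk_comp_eqToHom _ _)
  refine ⟨χ, hχ, algHom_ext (eq_of_isCleavageTrans (φ := whiskerLeft j.f.left.toFunctor ψ)
    (φ' := 𝟙 f.f.left.toFunctor) (fun a => hψ _) (fun a => (cleavage β).id_mem _)
    (congrArg (fun f => f.f.left.toFunctor) (?_ : j ≫ r ≫ f = f)) fun a => ?_)
    ((congrArg (j.f.right ≫ ·) hχ).trans hN.symm)⟩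
  · rw [reassoc_of% hr]
  have e : N.toFunctor.obj ((under γ).obj (j.f.left.toFunctor.obj a)) =
      (under β).obj (f.f.left.toFunctor.obj a) :=
    (congrArg N.toFunctor.obj (Functor.congr_obj (under_comp_right j) a).symm).trans <|
      (Functor.congr_obj (congrArg (fun K : α.A.right ⟶ β.A.right => under α ⋙ K.toFunctor)
        hN.symm) a).trans (Functor.congr_obj (under_comp_right f) a)
  calc Arrow.mk ((under β).map (ψ.app (j.f.left.toFunctor.obj a)))
    _ = Arrow.mk (N.toFunctor.map ((under γ).map (φ.app (j.f.left.toFunctor.obj a)))) :=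
      hψ_map _
    _ = Arrow.mk (𝟙 (N.toFunctor.obj ((under γ).obj (j.f.left.toFunctor.obj a)))) :=
      (congrArg N.toFunctor.mapArrow.obj (hj a)).trans (congrArg Arrow.mk (N.toFunctor.map_id _))
    _ = Arrow.mk (𝟙 ((under β).obj (f.f.left.toFunctor.obj a))) := by rw [e]
    _ = Arrow.mk ((under β).map (𝟙 (f.f.left.toFunctor.obj a))) :=
      congrArg Arrow.mk ((under β).map_id _).symm

lemma isStronglyCocartesian_of_retraction {j : α ⟶ γ} {r : γ ⟶ α} (hr : j ≫ r = 𝟙 α)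
    {φ : 𝟭 γ.A.left ⟶ (r ≫ j).f.left.toFunctor} (hφ : IsCleavageTrans φ)
    (hj : ∀ a, Arrow.mk ((under γ).map (φ.app (j.f.left.toFunctor.obj a))) =
      Arrow.mk (𝟙 ((under γ).obj (j.f.left.toFunctor.obj a)))) :
    algCod.IsStronglyCocartesian (S := γ.A.right) j.f.right j where
  toIsHomLift := IsHomLift.map algCod j
  universal_property' {β} (N : γ.A.right ⟶ β.A.right) f hf := by
    obtain ⟨χ, rfl, fac⟩ := exists_hom_comp_eq_of_retraction hr hφ hj N f
      (right_eq_of_isHomLift _ f (h := hf))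
    exact ⟨χ, ⟨IsHomLift.map algCod χ, fac⟩, fun χ' ⟨hχ', fac'⟩ =>
      hom_ext_of_retraction hφ (right_eq_of_isHomLift _ _ (h := hχ')) (fac'.trans fac.symm)⟩

end Cocartesian

section PathCocartesian

section

variable {𝒜 ℬ : Type u} [Category.{u} 𝒜] [Category.{u} ℬ] {F : 𝒜 ⥤ ℬ}

lemma eq_leftFactor_obj {Q Q' : MObj F} (f : Q ⟶ Q') (ha : Arrow.mk f.a = Arrow.mk (𝟙 Q'.src))
    (hb : Arrow.mk f.b = Arrow.mk Q'.iso.inv) : Q = (leftFactor F).obj Q'.src := by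
  obtain ⟨A, B, x⟩ := Q
  obtain ⟨b, a, w⟩ := f
  obtain rfl : A = Q'.src := congrArg Comma.left ha
  obtain rfl : B = F.obj Q'.src := congrArg Comma.left hb
  obtain rfl : a = 𝟙 _ := (Arrow.mk_inj _ _).1 ha
  obtain rfl : b = Q'.iso.inv := (Arrow.mk_inj _ _).1 hb
  obtain rfl : x = Iso.refl _ := by
    ext
    exact (Category.comp_id _).symm.trans <| (congrArg (x.hom ≫ ·) (F.map_id _).symm).trans <|
      w.symm.trans Q'.iso.inv_hom_id
  rfl

lemma toLeftFactor_app_eq_eqToHom {Q : MObj F} {A : 𝒜} (h : Q = (leftFactor F).obj A) :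
    (toLeftFactor F).app Q =
      eqToHom (h.trans (congrArg (leftFactor F).obj (congrArg MObj.src h).symm)) := by
  subst h
  rfl

lemma comp_srcFunctor_comp_leftFactor {𝒟 : Type*} [Category* 𝒟] {H : 𝒟 ⥤ MObj F}
    (h : ∀ d, ∃ A, H.obj d = (leftFactor F).obj A) : H ⋙ srcFunctor F ⋙ leftFactor F = H :=
  have _ (d) : IsIso ((whiskerLeft H (toLeftFactor F)).app d) :=
    inferInstanceAs (IsIso ((toLeftFactor F).app (H.obj d)))
  have := NatIso.isIso_of_isIso_app (whiskerLeft H (toLeftFactor F))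
  (Functor.ext_of_iso (asIso (whiskerLeft H (toLeftFactor F))) _
    fun d => toLeftFactor_app_eq_eqToHom (h d).choose_spec).symm

end

/-- The family of isomorphisms of `X` given by a morphism to `pathAlg X`. -/
abbrev paths {γ : RAlg.{u}} {X : Cat.{u, u}} (k : γ ⟶ pathAlg X) : γ.A.left ⥤ MObj (𝟭 X) :=
  k.f.left.toFunctor

lemma eq_toIdAlg_comp_reflHom {γ : RAlg.{u}} {X : Cat.{u, u}} {k : γ ⟶ pathAlg X}
    {f : γ.A.right ⟶ X} (hr : k.f.right = f ≫ lift (𝟙 X) (𝟙 X))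
    (h : ∀ e, ∃ x, (paths k).obj e = (leftFactor (𝟭 X)).obj x) :
    k = toIdAlg γ f ≫ reflHom X := by
  have hsrc : paths k ⋙ srcFunctor (𝟭 X) = under γ ⋙ f.toFunctor :=
    congrArg (· ⋙ CategoryTheory.Prod.fst X X) <| (under_comp_right k).symm.trans
      (congrArg (fun g : γ.A.right ⟶ X ⊗ X => under γ ⋙ g.toFunctor) hr)
  exact algHom_ext ((comp_srcFunctor_comp_leftFactor h).symm.trans
    (congrArg (· ⋙ leftFactor (𝟭 X)) hsrc)) hr

lemma comp_eq_toIdAlg_comp_reflHom {γ : RAlg.{u}} {X : Cat.{u, u}} {k : γ ⟶ pathAlg X}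
    {τ : γ ⟶ γ} {φ : τ.f.left.toFunctor ⟶ 𝟭 γ.A.left} {f : γ.A.right ⟶ X}
    (hr : τ.f.right ≫ k.f.right = f ≫ lift (𝟙 X) (𝟙 X))
    (hφ : ∀ e, Arrow.mk (k.f.right.toFunctor.map ((under γ).map (φ.app e))) =
      Arrow.mk (𝟙 ((paths k).obj e).src ×ₘ ((paths k).obj e).iso.inv)) :
    τ ≫ k = toIdAlg γ f ≫ reflHom X := by
  refine eq_toIdAlg_comp_reflHom hr fun e => ⟨((paths k).obj e).src, ?_⟩
  have hφe : Arrow.mk ((endpoints X).map ((paths k).map (φ.app e))) =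
      Arrow.mk (𝟙 ((paths k).obj e).src ×ₘ ((paths k).obj e).iso.inv) :=
    (congrArg (fun G : γ.A.left ⥤ X × X => G.mapArrow.obj (Arrow.mk (φ.app e)))
      (under_comp_right k).symm).trans (hφ e)
  exact eq_leftFactor_obj ((paths k).map (φ.app e))
    (congrArg (CategoryTheory.Prod.fst X X).mapArrow.obj hφe)
    (congrArg (CategoryTheory.Prod.snd X X).mapArrow.obj hφe)

variable {α γ : RAlg.{u}} {X : Cat.{u, u}} {P : α.A.right ⟶ X} {j : α ⟶ γ} {k : γ ⟶ pathAlg X}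

lemma isStronglyCocartesian_of_isPullback (H : IsPullback j (toIdAlg α P) k (reflHom X))
    {g : α.A.right ⟶ γ.A.right} {g' : γ.A.right ⟶ X ⊗ X} (hj : j.f.right = g)
    (hk : k.f.right = g') {s : γ.A.right ⟶ α.A.right} (hs : g ≫ s = 𝟙 _)
    (ω : under γ ⋙ (s ≫ g).toFunctor ≅ under γ)
    (hω_j : ∀ a, Arrow.mk (ω.hom.app (j.f.left.toFunctor.obj a)) =
      Arrow.mk (𝟙 ((under γ).obj (j.f.left.toFunctor.obj a))))
    (hω_k : ∀ e, Arrow.mk (g'.toFunctor.map (ω.hom.app e)) =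
      Arrow.mk (𝟙 ((paths k).obj e).src ×ₘ ((paths k).obj e).iso.inv)) :
    algCod.IsStronglyCocartesian (S := γ.A.right) g j := by
  subst hj hk
  obtain ⟨τ, φ, hτ, hφ, hω⟩ := exists_hom_isCleavageTrans (𝟙 γ) (s ≫ j.f.right) ω
  have hw : j.f.right ≫ k.f.right = P ≫ lift (𝟙 X) (𝟙 X) := congrArg (fun f => f.f.right) H.w
  have hτr : τ.f.right ≫ k.f.right = (s ≫ P) ≫ lift (𝟙 X) (𝟙 X) :=
    (congrArg (· ≫ k.f.right) hτ).trans <| (Category.assoc _ _ _).trans <|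
      (congrArg (s ≫ ·) hw).trans (Category.assoc _ _ _).symm
  have hτk : τ ≫ k = toIdAlg γ (s ≫ P) ≫ reflHom X :=
    comp_eq_toIdAlg_comp_reflHom hτr fun e =>
      (congrArg k.f.right.toFunctor.mapArrow.obj (hω e)).trans (hω_k e)
  obtain ⟨r, rfl, hr⟩ := H.exists_lift τ _ hτk
  have hφj (a) : Arrow.mk ((under γ).map (φ.app (j.f.left.toFunctor.obj a))) =
      Arrow.mk (𝟙 ((under γ).obj (j.f.left.toFunctor.obj a))) := (hω _).trans (hω_j a)
  have hjrj : j ≫ r ≫ j = j := by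
    refine algHom_ext (eq_of_isCleavageTrans (φ := whiskerLeft j.f.left.toFunctor φ)
      (φ' := 𝟙 j.f.left.toFunctor) (fun a => hφ _) (fun a => (cleavage γ).id_mem _) rfl fun a =>
      (hφj a).trans (congrArg Arrow.mk ((under γ).map_id _).symm)) ?_
    exact (congrArg (j.f.right ≫ ·) hτ).trans (by rw [reassoc_of% hs])
  have hjr : j ≫ r = 𝟙 α := by
    refine H.hom_ext ((Category.assoc _ _ _).trans (hjrj.trans (Category.id_comp _).symm))
      (hom_idAlg_ext ?_)
    rw [Category.assoc, hr, Category.id_comp]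
    change j.f.right ≫ s ≫ P = P
    rw [reassoc_of% hs]
  have := hφ.isIso
  exact isStronglyCocartesian_of_retraction hjr (φ := (asIso φ).inv) hφ.inv fun a =>
    arrowMk_inv_eq_id (e := (under γ).mapIso ((asIso φ).app _)) (hφj a)

section

variable {𝒟 𝒲 𝒳 : Type u} [Category.{u} 𝒟] [Category.{u} 𝒲] [Category.{u} 𝒳]

/-- The isomorphism `x⁻¹ : A ≅ B`, natural in `x : B ≅ A`. -/
def srcIsoPt (𝒳 : Type u) [Category.{u} 𝒳] : srcFunctor (𝟭 𝒳) ≅ rightFactor (𝟭 𝒳) :=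
  NatIso.ofComponents (fun Q => Q.iso.symm) fun {Q Q'} f =>
    (CommSq.horiz_inv (f := Q.iso) (i := Q'.iso) ⟨f.w.symm⟩).w.symm

/-- Given a functor `K = (K₁, K₂)` to `𝒲 × 𝒳` and isomorphisms `k d : K₂ d ≅ P (K₁ d)`, the
induced isomorphism `(K₁, P K₁) ≅ (K₁, K₂)`. -/
def graphIso {K : 𝒟 ⥤ 𝒲 × 𝒳} {P : 𝒲 ⥤ 𝒳} {k : 𝒟 ⥤ MObj (𝟭 𝒳)}
    (h : K ⋙ P.prod (𝟭 𝒳) = k ⋙ endpoints 𝒳) :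
    K ⋙ CategoryTheory.Prod.fst 𝒲 𝒳 ⋙ (𝟭 𝒲).prod' P ≅ K :=
  have hfst := congrArg (· ⋙ CategoryTheory.Prod.fst 𝒳 𝒳) h
  have hsnd := congrArg (· ⋙ CategoryTheory.Prod.snd 𝒳 𝒳) h
  let θ : K ⋙ CategoryTheory.Prod.fst 𝒲 𝒳 ⋙ P ≅ K ⋙ CategoryTheory.Prod.snd 𝒲 𝒳 :=
    eqToIso hfst ≪≫ isoWhiskerLeft k (srcIsoPt 𝒳) ≪≫ eqToIso hsnd.symm
  NatIso.ofComponents (fun d => Iso.prod (Iso.refl (K.obj d).1) (θ.app d)) fun f =>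
    Prod.ext ((Category.comp_id _).trans (Category.id_comp _).symm) (θ.hom.naturality f)

variable {K : 𝒟 ⥤ 𝒲 × 𝒳} {P : 𝒲 ⥤ 𝒳} {k : 𝒟 ⥤ MObj (𝟭 𝒳)}
  (h : K ⋙ P.prod (𝟭 𝒳) = k ⋙ endpoints 𝒳) (d : 𝒟)

lemma arrowMk_snd_graphIso_hom_app :
    Arrow.mk ((graphIso h).hom.app d).2 = Arrow.mk (k.obj d).iso.inv :=
  have hsnd := congrArg (· ⋙ CategoryTheory.Prod.snd 𝒳 𝒳) h
  have hfst := congrArg (· ⋙ CategoryTheory.Prod.fst 𝒳 𝒳) h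
  calc Arrow.mk ((eqToHom hfst).app d ≫ (k.obj d).iso.inv ≫ (eqToHom hsnd.symm).app d)
    _ = Arrow.mk ((k.obj d).iso.inv ≫ (eqToHom hsnd.symm).app d) := by
      rw [eqToHom_app]
      exact Arrow.arrow_mk_eqToHom_comp _ _
    _ = Arrow.mk (k.obj d).iso.inv := by
      rw [eqToHom_app]
      exact Arrow.arrow_mk_comp_eqToHom _ _

lemma arrowMk_map_graphIso_hom_app :
    Arrow.mk ((P.prod (𝟭 𝒳)).map ((graphIso h).hom.app d)) =
      Arrow.mk (𝟙 (k.obj d).src ×ₘ (k.obj d).iso.inv) := by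
  have hfst : P.obj (K.obj d).1 = (k.obj d).src := congrArg Prod.fst (Functor.congr_obj h d)
  have h₁ : Arrow.mk (P.map (𝟙 (K.obj d).1)) = Arrow.mk (𝟙 (k.obj d).src) := by
    rw [P.map_id, hfst]
  exact arrowMk_mkHom_congr h₁ (arrowMk_snd_graphIso_hom_app h d)

lemma arrowMk_graphIso_hom_app_eq_id {x : 𝒳} (hd : k.obj d = (leftFactor (𝟭 𝒳)).obj x) :
    Arrow.mk ((graphIso h).hom.app d) = Arrow.mk (𝟙 (K.obj d)) :=
  arrowMk_mkHom_congr rfl <| (arrowMk_snd_graphIso_hom_app h d).trans (by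
    have hsnd : (K.obj d).2 = (k.obj d).pt := congrArg Prod.snd (Functor.congr_obj h d)
    rw [hsnd, hd]
    rfl)

end

/-- The path objects of `algCod`, given by the algebras of isomorphisms. -/
def pathObjects : PathObjects fibredTerminal.{u} where
  obj X := ⟨pathAlg X, rfl⟩
  refl := reflHom
  refl_isHomLift X := IsHomLift.map algCod (reflHom X)
  isCocartesian {W X} P {A C} j k hj hk H := by
    obtain ⟨α, rfl⟩ := A
    obtain ⟨⟨⟨L, R, F⟩, a, u, m⟩, hC⟩ := C
    obtain rfl : R = _ := hC
    have hj' := right_eq_of_isHomLift (α := α) (lift (𝟙 α.A.right) P) j (h := hj)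
    have hk' := right_eq_of_isHomLift (β := pathAlg X) (P ▷ X) k (h := hk)
    have hγ : under ⟨_, a, u, m⟩ ⋙ P.toFunctor.prod (𝟭 X) = paths k ⋙ endpoints X :=
      (congrArg (fun f : α.A.right ⊗ X ⟶ X ⊗ X => F.toFunctor ⋙ f.toFunctor) hk').symm.trans
        (under_comp_right k)
    have hjk (a) : (paths k).obj (j.f.left.toFunctor.obj a) =
        (leftFactor (𝟭 X)).obj (P.toFunctor.obj ((under α).obj a)) :=
      Functor.congr_obj (congrArg (fun f => f.f.left.toFunctor) H.w) a
    have : algCod.IsStronglyCocartesian (lift (𝟙 (algCod.obj α)) P) j :=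
      isStronglyCocartesian_of_isPullback H hj' hk' (lift_fst _ _) (graphIso hγ)
      (fun a => arrowMk_graphIso_hom_app_eq_id hγ _ (hjk a))
      (fun e => arrowMk_map_graphIso_hom_app hγ e)
    exact inferInstance

end PathCocartesian

end ElementaryFib

theorem proposition5p4 : ElementaryFib.IsElementaryFibration ElementaryFib.algCod.{u} :=
  ElementaryFib.isElementaryFibration ElementaryFib.isIsofibration_algCod ElementaryFib.pathObjects
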